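/- Let $d\in\mathbb N$. For a probability measure $\pi$ on a Euclidean space $E$ write $\mathbb E_\pi[f]=\int f\,d\pi$, $\mathsf{var}_\pi[f]=\mathbb E_\pi[f^2]-(\mathbb E_\pi[f])^2$, and, for a convex function $\Phi:\mathcal S\to\mathbb R$ on a convex set $\mathcal S\subseteq\mathbb R$, $\mathbb J^\Phi_\pi[f]=\mathbb E_\pi[\Phi(f)]-\Phi(\mathbb E_\pi[f])$. For $\gamma>0$ we say that - $\pi$ satisfies the $\Phi$-Sobolev inequality $\Phi\mathrm{SI}(\gamma)$ if $\mathbb J^\Phi_\pi[f]\le\frac{\gamma}{2}\,\mathbb E_\pi[\Phi''(f)\,\|\nabla f\|^2]$ for all smooth $f:E\to\mathcal S$ that are constant outside a compact set; - $\pi$ satisfies $\mathrm{PI}(\gamma)$ if $\mathsf{var}_\pi[f]\le\gamma\,\mathbb E_\pi[\|\nabla f\|^2]$ for all $f\in C_c^\infty(E)$; - $\pi$ satisfies $\mathrm{LSI}(\gamma)$ if $\mathbb E_\pi[f^2\log f^2]-\mathbb E_\pi[f^2]\log\mathbb E_\pi[f^2]\le 2\gamma\,\mathbb E_\pi[\|\nabla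 f\|^2]$ for all $f\in C_c^\infty(E)$, with the convention $0\log 0=0$. Let $\rho$ be a probability measure on $\mathbb R^d$ that has a density with respect to Lebesgue measure. Let $G:\mathbb R^d\times\mathbb R^d\to\mathbb R$ be measurable with $Z(y)=\int\exp(-G(x,y))\,dx<\infty$ for every $y$, put $p_{X|Y=y}(x)=\exp(-G(x,y))/Z(y)$, and assume that $y\mapsto p_{X|Y=y}(x)$ is differentiable on $\mathbb R^d$ for every $x$. Let $P_{X|Y=y}$ be the probability measure with density $p_{X|Y=y}$, and let $\nu$ be the joint law $d\nu(x,y)=dP_{X|Y=y}(x)\,d\rho(y)$ on the Euclidean space $\mathbb R^d\times\mathbb R^d$. For $\bar L>0$ consider the criteria $$\textsf{(Var)}\qquad \mathbb E_{x\sim P_{X|Y=y}}\big[\langle u,\nabla_y\log p_{X|Y=y}(x)\rangle^2\big]\le\bar L^2\|u\|^2\quad\text{for all }u,y\in\mathbb R^d,$$ $$\textsf{(MGF)}\qquad \log\mathbb E_{x\sim P_{X|Y=y}}\big[\exp\langle u,\nabla_y\log p_{X|Y=y}(x)\rangle\big]\le\tfrac12\bar L^2\|u\|^2\quad\text{for all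 }u,y\in\mathbb R^d .$$ Let $\alpha,\beta,\bar L>0$ and define $$\zeta=\inf_{C>0}\max\big\{\beta+\alpha(1+C^{-1})\bar L^2\beta,\ \alpha(1+C)\big\}.$$ Then $$\zeta=\tfrac12\Big(\alpha+\beta+\alpha\beta\bar L^2+\sqrt{4\alpha^2\beta\bar L^2+(\beta-\alpha+\alpha\beta\bar L^2)^2}\Big),$$ and the following hold. 1. Let $\Phi(t)=t^2$ and $\mathcal S=\mathbb R$. If $\rho$ satisfies $\Phi\mathrm{SI}(\alpha)$, $P_{X|Y=y}$ satisfies $\Phi\mathrm{SI}(\beta)$ for every $y$, and (Var) holds with $\bar L$, then $\nu$ satisfies $\mathrm{PI}(\zeta)$. 2. Let $\Phi(t)=t\log t$ and $\mathcal S=(0,\infty)$. If $\rho$ satisfies $\Phi\mathrm{SI}(\alpha)$, $P_{X|Y=y}$ satisfies $\Phi\mathrm{SI}(\beta)$ for every $y$, and (MGF) holds with $\bar L$, then $\nu$ satisfies $\mathrm{LSI}(\zeta)$. -/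

import Mathlib

open MeasureTheory
open scoped ContDiff

noncomputable section

namespace TwoScale

/-- The Euclidean space `ℝ^d`. -/
abbrev Euc (d : ℕ) : Type := EuclideanSpace ℝ (Fin d)

/-- The Euclidean space `ℝ^d × ℝ^d`, with `‖(x, y)‖² = ‖x‖² + ‖y‖²`. -/
abbrev EucProd (d : ℕ) : Type := WithLp 2 (Euc d × Euc d)

section Inequalities

variable {F : Type*} [NormedAddCommGroup F] [InnerProductSpace ℝ F] [CompleteSpace F]
  [MeasurableSpace F]

/-- The `Φ`-entropy `E_π[Φ(f)] - Φ(E_π[f])`. -/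
def phiEntropy (Φ : ℝ → ℝ) (π : Measure F) (f : F → ℝ) : ℝ :=
  (∫ x, Φ (f x) ∂π) - Φ (∫ x, f x ∂π)

/-- The function `t ↦ t log t`. -/
def mulLog (t : ℝ) : ℝ := t * Real.log t

/-- The `Φ`-Sobolev inequality with constant `γ` for `Φ : S → ℝ`: the test functions are the
smooth functions with values in `S` that are constant outside a compact set. (Compact support
alone would leave no test function at all when `0 ∉ S`, as for `S = (0, ∞)`.) -/
def PhiSobolev (S : Set ℝ) (Φ : ℝ → ℝ) (π : Measure F) (γ : ℝ) : Prop :=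
  0 < γ ∧ ∀ f : F → ℝ, ContDiff ℝ ∞ f → (∃ c : ℝ, HasCompactSupport (fun x => f x - c)) →
    (∀ x, f x ∈ S) →
      phiEntropy Φ π f ≤ γ / 2 * ∫ x, deriv (deriv Φ) (f x) * ‖gradient f x‖ ^ 2 ∂π

/-- The Poincaré inequality `PI(γ)`. -/
def Poincare (π : Measure F) (γ : ℝ) : Prop :=
  0 < γ ∧ ∀ f : F → ℝ, ContDiff ℝ ∞ f → HasCompactSupport f →
    ProbabilityTheory.variance f π ≤ γ * ∫ x, ‖gradient f x‖ ^ 2 ∂π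

/-- The log-Sobolev inequality `LSI(γ)`: `ent_π[f²] ≤ 2 γ E_π[‖∇f‖²]`. -/
def LogSobolev (π : Measure F) (γ : ℝ) : Prop :=
  0 < γ ∧ ∀ f : F → ℝ, ContDiff ℝ ∞ f → HasCompactSupport f →
    phiEntropy mulLog π (fun x => f x ^ 2) ≤ 2 * γ * ∫ x, ‖gradient f x‖ ^ 2 ∂π

end Inequalities

section Setup

variable {d : ℕ} (G : Euc d → Euc d → ℝ)

/-- The normalisation constant `Z(y) = ∫ exp(-G(x, y)) dx`. -/
def normConst (y : Euc d) : ℝ := ∫ x, Real.exp (-G x y)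

/-- The conditional density `p_{X|Y=y}(x) = exp(-G(x, y)) / Z(y)`. -/
def condDensity (x y : Euc d) : ℝ := Real.exp (-G x y) / normConst G y

/-- The conditional distribution `P_{X|Y=y}`. -/
def condLaw (y : Euc d) : Measure (Euc d) :=
  volume.withDensity fun x => ENNReal.ofReal (condDensity G x y)

/-- The joint law `dν(x, y) = dP_{X|Y=y}(x) dρ(y)` on the Euclidean space `ℝ^d × ℝ^d`. -/
def jointLaw (ρ : Measure (Euc d)) : Measure (EucProd d) :=
  (((volume : Measure (Euc d)).prod ρ).withDensity
    fun z => ENNReal.ofReal (condDensity G z.1 z.2)).map (WithLp.toLp 2)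

/-- The score `∇_y log p_{X|Y=y}(x)`. -/
def score (x y : Euc d) : Euc d := gradient (fun y' => Real.log (condDensity G x y')) y

/-- The variance criterion; finiteness of the expectation is part of it. -/
def VarCriterion (L : ℝ) : Prop :=
  ∀ u y : Euc d, Integrable (fun x => inner ℝ u (score G x y) ^ 2) (condLaw G y) ∧
    ∫ x, inner ℝ u (score G x y) ^ 2 ∂(condLaw G y) ≤ L ^ 2 * ‖u‖ ^ 2

/-- The moment generating function criterion; finiteness of the expectation is part of it. -/
def MGFCriterion (L : ℝ) : Prop :=
  ∀ u y : Euc d, Integrable (fun x => Real.exp (inner ℝ u (score G x y))) (condLaw G y) ∧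
    Real.log (∫ x, Real.exp (inner ℝ u (score G x y)) ∂(condLaw G y)) ≤ L ^ 2 * ‖u‖ ^ 2 / 2

end Setup

/-- `ζ = inf_{C > 0} max {β + α (1 + C⁻¹) L² β, α (1 + C)}`. -/
def zeta (α β L : ℝ) : ℝ :=
  ⨅ C : Set.Ioi (0 : ℝ),
    max (β + α * (1 + (C : ℝ)⁻¹) * L ^ 2 * β) (α * (1 + (C : ℝ)))

end TwoScale

end

open Filter Topology

namespace TwoScale


/-! Write k(y) for the conditional mean of f(·, y). The entropy of f under the joint law is the
ρ-average of the conditional entropies plus the ρ-entropy of k. The inequality for the conditional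
laws bounds the first term by β/2 times the x-energy. For the second, the inequality for ρ is
applied to k, whose gradient is E[∇_y f] + E[f · score]. The first summand is controlled by a
(weighted) Jensen inequality. The second is a covariance of f with the score: Cauchy-Schwarz with
(Var), or the Donsker-Varadhan inequality with (MGF), bounds its square by the conditional entropy,
hence again by the x-energy. Young's inequality with parameter C separates the two summands; the
coefficients of the x- and y-energies are then the two terms in the maximum defining ζ, and C is
optimised (`phiEntropy_jointLaw_le`, `le_zeta_mul`).

The analytic difficulty is that the density is only differentiable in y, with no domination, so k
need not be smooth and cannot be differentiated under the integral pointwise. Instead, Fubini and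
the fundamental theorem of calculus on segments give ∇k in integrated form
(`BddGradient.condAvg_sub_eq_intervalIntegral`). Mollifying k produces admissible test functions
whose gradients are the mollified ∇k, and these converge Lebesgue-a.e.; since ρ is absolutely
continuous, the inequality passes to the limit (`PhiSobolev.of_line_integral`). The same device
shows that the score has mean zero for almost every y. -/

theorem zeta_eq {α β L : ℝ} (hα : 0 < α) (hβ : 0 < β) (hL : 0 < L) :
    zeta α β L = (α + β + α * β * L ^ 2
      + Real.sqrt (4 * α ^ 2 * β * L ^ 2 + (β - α + α * β * L ^ 2) ^ 2)) / 2 := by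
  set s := Real.sqrt (4 * α ^ 2 * β * L ^ 2 + (β - α + α * β * L ^ 2) ^ 2) with hs
  have hpos : 0 < 4 * α ^ 2 * β * L ^ 2 := by positivity
  have hsq : s ^ 2 = 4 * α ^ 2 * β * L ^ 2 + (β - α + α * β * L ^ 2) ^ 2 :=
    Real.sq_sqrt (by positivity)
  have hs0 : 0 ≤ s := Real.sqrt_nonneg _
  have habs : |β - α + α * β * L ^ 2| < s := by
    apply abs_lt_of_sq_lt_sq _ hs0
    rw [hsq]; linarith
  set z := (α + β + α * β * L ^ 2 + s) / 2 with hz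
  have hza : 0 < z - α := by
    have := (abs_lt.mp habs).1
    rw [hz]; linarith
  -- One term of the maximum decreases in C and the other increases, so the optimum is where both
  -- equal z. Eliminating C gives this quadratic, of which z is the larger root.
  have hquad : (z - α) * (z - β - α * β * L ^ 2) = α ^ 2 * β * L ^ 2 := by
    have h4 : 4 * ((z - α) * (z - β - α * β * L ^ 2))
        = s ^ 2 - (β - α + α * β * L ^ 2) ^ 2 := by rw [hz]; ring
    rw [hsq] at h4; linarith
  have : Nonempty (Set.Ioi (0 : ℝ)) := ⟨⟨1, by simp⟩⟩
  have hbdd : BddBelow (Set.range fun C : Set.Ioi (0 : ℝ) =>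
      max (β + α * (1 + (C : ℝ)⁻¹) * L ^ 2 * β) (α * (1 + (C : ℝ)))) := by
    refine ⟨0, ?_⟩
    rintro _ ⟨⟨C, hC⟩, rfl⟩
    have hC' : 0 < C := hC
    exact le_max_of_le_right (by positivity)
  apply le_antisymm
  -- This C solves α(1 + C) = z; by the quadratic the other term then equals z as well.
  · have hC : 0 < (z - α) / α := div_pos hza hα
    refine (ciInf_le hbdd ⟨(z - α) / α, hC⟩).trans ?_
    apply max_le
    · have : ((z - α) / α)⁻¹ = α / (z - α) := by rw [inv_div]
      have h2 : α * (α / (z - α)) * L ^ 2 * β = z - β - α * β * L ^ 2 := by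
        field_simp
        linarith
      show β + α * (1 + ((z - α) / α)⁻¹) * L ^ 2 * β ≤ z
      rw [this]; linarith
    · show α * (1 + (z - α) / α) ≤ z
      apply le_of_eq; field_simp; ring
  · refine le_ciInf ?_
    rintro ⟨C, hC⟩
    have hC' : 0 < C := hC
    show z ≤ max (β + α * (1 + C⁻¹) * L ^ 2 * β) (α * (1 + C))
    -- If both terms were below z, multiplying the two strict inequalities would cancel C and
    -- contradict the quadratic.
    by_contra! hlt
    obtain ⟨h1, h2⟩ := max_lt_iff.mp hlt
    have h3 : α * C < z - α := by linarith
    have h4 : α * C⁻¹ * L ^ 2 * β < z - β - α * β * L ^ 2 := by linarith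
    have h5 : (α * C) * (α * C⁻¹ * L ^ 2 * β) < (z - α) * (z - β - α * β * L ^ 2) :=
      mul_lt_mul'' h3 h4 (by positivity) (by positivity)
    rw [hquad] at h5
    have : (α * C) * (α * C⁻¹ * L ^ 2 * β) = α ^ 2 * β * L ^ 2 := by
      field_simp
    linarith

/-! ### Mollification and extension of Φ-Sobolev inequalities to Lipschitz-type functions -/

section Mollification

variable {E : Type*} [NormedAddCommGroup E] [InnerProductSpace ℝ E] [FiniteDimensional ℝ E]
  [MeasurableSpace E] [BorelSpace E]

/-- The convolution of `g` with a normalised bump function. -/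
noncomputable def mollify {V : Type*} [NormedAddCommGroup V] [NormedSpace ℝ V]
    (φ : ContDiffBump (0 : E)) (g : E → V) : E → V :=
  convolution (φ.normed volume) g (ContinuousLinearMap.lsmul ℝ ℝ) volume

theorem mollify_apply {V : Type*} [NormedAddCommGroup V] [NormedSpace ℝ V]
    (φ : ContDiffBump (0 : E)) (g : E → V) (y : E) :
    mollify φ g y = ∫ z, φ.normed volume z • g (y - z) := rfl

theorem integrable_normed_smul {V : Type*} [NormedAddCommGroup V] [NormedSpace ℝ V]
    [MeasurableSpace V] [BorelSpace V] [SecondCountableTopology V]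
    (φ : ContDiffBump (0 : E)) {g : E → V} (hg : Measurable g) {B : ℝ} (hB : ∀ y, ‖g y‖ ≤ B)
    (y : E) : Integrable (fun z => φ.normed volume z • g (y - z)) := by
  refine ((φ.integrable_normed (μ := volume)).mul_const B).mono' ?_ (ae_of_all _ fun z => ?_)
  · exact ((φ.continuous_normed (μ := volume)).measurable.smul
      (hg.comp (by fun_prop))).aestronglyMeasurable
  · rw [norm_smul, Real.norm_of_nonneg (φ.nonneg_normed z)]
    exact mul_le_mul_of_nonneg_left (hB _) (φ.nonneg_normed z)

theorem norm_mollify_le {V : Type*} [NormedAddCommGroup V] [NormedSpace ℝ V]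
    (φ : ContDiffBump (0 : E)) {g : E → V} {B : ℝ} (hB : ∀ y, ‖g y‖ ≤ B)
    (y : E) : ‖mollify φ g y‖ ≤ B := by
  rw [mollify_apply]
  have := norm_integral_le_of_norm_le (f := fun z => φ.normed volume z • g (y - z))
    (μ := volume) (g := fun z => φ.normed volume z * B)
    ((φ.integrable_normed (μ := volume)).mul_const B) (ae_of_all _ fun z => by
      rw [norm_smul, Real.norm_of_nonneg (φ.nonneg_normed z)]
      exact mul_le_mul_of_nonneg_left (hB _) (φ.nonneg_normed z))
  rwa [integral_mul_const, φ.integral_normed, one_mul] at this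

/-- An average of values in an interval stays there. This keeps the mollified functions in a compact
part of S, where Φ'' is bounded. -/
theorem mollify_mem_Icc (φ : ContDiffBump (0 : E)) {k : E → ℝ} (hk : Measurable k) {a b : ℝ}
    (hab : ∀ y, k y ∈ Set.Icc a b) (y : E) : mollify φ k y ∈ Set.Icc a b := by
  have hB : ∀ y, ‖k y‖ ≤ max |a| |b| := fun y => abs_le_max_abs_abs (hab y).1 (hab y).2
  have hi := integrable_normed_smul φ hk hB y
  have hφ := φ.integrable_normed (μ := volume)
  rw [mollify_apply]
  constructor
  · have := integral_mono (hφ.mul_const a) hi fun z =>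
      mul_le_mul_of_nonneg_left (hab (y - z)).1 (φ.nonneg_normed z)
    rwa [integral_mul_const, φ.integral_normed, one_mul] at this
  · have := integral_mono hi (hφ.mul_const b) fun z =>
      mul_le_mul_of_nonneg_left (hab (y - z)).2 (φ.nonneg_normed z)
    rwa [integral_mul_const, φ.integral_normed, one_mul] at this

theorem contDiff_mollify (φ : ContDiffBump (0 : E)) {k : E → ℝ} (hk : Continuous k) :
    ContDiff ℝ ∞ (mollify φ k) :=
  HasCompactSupport.contDiff_convolution_left _ φ.hasCompactSupport_normed
    φ.contDiff_normed hk.locallyIntegrable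

theorem hasCompactSupport_mollify_sub (φ : ContDiffBump (0 : E)) {k : E → ℝ}
    (hk : Continuous k) {c : ℝ} (hc : HasCompactSupport fun y => k y - c) {B : ℝ}
    (hB : ∀ y, ‖k y‖ ≤ B) : HasCompactSupport fun y => mollify φ k y - c := by
  have : (fun y => mollify φ k y - c) = mollify φ fun y => k y - c := by
    funext y
    simp only [mollify_apply, smul_sub]
    rw [integral_sub (integrable_normed_smul φ hk.measurable hB y)
      ((φ.integrable_normed (μ := volume)).smul_const c), integral_smul_const,
      φ.integral_normed, one_smul]
  rw [this]
  exact HasCompactSupport.convolution _ φ.hasCompactSupport_normed hc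

theorem locallyIntegrable_of_bound {g : E → E} (hg : Measurable g) {B : ℝ}
    (hB : ∀ y, ‖g y‖ ≤ B) : LocallyIntegrable g (volume : Measure E) := by
  intro x
  obtain ⟨s, hs, hfin⟩ := (volume : Measure E).exists_isOpen_measure_lt_top x
    |>.imp fun s h => (⟨h.2.1.mem_nhds h.1, h.2.2⟩ : s ∈ 𝓝 x ∧ volume s < ⊤)
  exact ⟨s, hs, Measure.integrableOn_of_bounded hfin.ne hg.aestronglyMeasurable
    (ae_of_all _ hB)⟩

/-- The line identity is translation invariant, so it survives averaging over translates; Fubini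
moves the average inside the integral over s. -/
theorem mollify_sub_eq_intervalIntegral (φ : ContDiffBump (0 : E)) {k : E → ℝ} {g : E → E}
    (hk : Measurable k) {A : ℝ} (hA : ∀ y, ‖k y‖ ≤ A)
    (hg : Measurable g) {B : ℝ} (hB : ∀ y, ‖g y‖ ≤ B)
    (hline : ∀ y v t, k (y + t • v) - k y = ∫ s in (0 : ℝ)..t, inner ℝ v (g (y + s • v)))
    (y v : E) (t : ℝ) :
    mollify φ k (y + t • v) - mollify φ k y
      = ∫ s in (0 : ℝ)..t, inner ℝ v (mollify φ g (y + s • v)) := by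
  have hinner : ∀ s : ℝ, inner ℝ v (mollify φ g (y + s • v))
      = ∫ z, φ.normed volume z * inner ℝ v (g (y + s • v - z)) := fun s => by
    rw [mollify_apply, ← integral_inner (integrable_normed_smul φ hg hB _)]
    simp only [inner_smul_right]
  simp only [hinner]
  rw [intervalIntegral_integral_swap, mollify_apply, mollify_apply,
    ← integral_sub (integrable_normed_smul φ hk hA _) (integrable_normed_smul φ hk hA _)]
  · refine integral_congr_ae (ae_of_all _ fun z => ?_)
    simp only
    rw [← smul_sub, intervalIntegral.integral_const_mul, smul_eq_mul]
    have := hline (y - z) v t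
    rw [show y + t • v - z = y - z + t • v by abel, this]
    simp only [show ∀ s : ℝ, y + s • v - z = y - z + s • v from fun s => by abel]
  · have hdom : Integrable (fun p : ℝ × E => (1 : ℝ) * (φ.normed volume p.2 * (‖v‖ * B)))
        ((volume.restrict (Set.uIoc 0 t)).prod volume) := by
      refine Integrable.mul_prod (f := fun _ : ℝ => (1 : ℝ))
        (g := fun z => φ.normed volume z * (‖v‖ * B)) ?_ ?_
      · exact (integrableOn_const (by simp)).mono_set Set.Subset.rfl
      · exact (φ.integrable_normed (μ := volume)).mul_const _
    refine hdom.mono' ?_ (ae_of_all _ fun p => ?_)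
    · refine Measurable.aestronglyMeasurable ?_
      simp only [Function.uncurry_def]
      refine Measurable.mul ?_ ?_
      · exact (φ.continuous_normed (μ := volume)).measurable.comp measurable_snd
      · exact (measurable_const.inner (hg.comp (by fun_prop)))
    · simp only [Function.uncurry_def, one_mul]
      rw [norm_mul, Real.norm_of_nonneg (φ.nonneg_normed _)]
      refine mul_le_mul_of_nonneg_left ?_ (φ.nonneg_normed _)
      exact (norm_inner_le_norm _ _).trans (mul_le_mul_of_nonneg_left (hB _) (norm_nonneg _))

/-- The mollified g is continuous, so the averaged line identity can be differentiated at t = 0.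
Thus no pointwise differentiability of k is needed. -/
theorem gradient_mollify (φ : ContDiffBump (0 : E)) {k : E → ℝ} {g : E → E}
    (hk : Continuous k) {A : ℝ} (hA : ∀ y, ‖k y‖ ≤ A)
    (hg : Measurable g) {B : ℝ} (hB : ∀ y, ‖g y‖ ≤ B)
    (hline : ∀ y v t, k (y + t • v) - k y = ∫ s in (0 : ℝ)..t, inner ℝ v (g (y + s • v)))
    (y : E) : gradient (mollify φ k) y = mollify φ g y := by
  have hG : Continuous (mollify φ g) := HasCompactSupport.continuous_convolution_left _
    φ.hasCompactSupport_normed φ.continuous_normed (locallyIntegrable_of_bound hg hB)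
  refine ext_inner_right ℝ fun v => ?_
  rw [inner_gradient_left]
  have hd : DifferentiableAt ℝ (mollify φ k) y :=
    (contDiff_mollify φ hk).differentiable (by simp) y
  have hlin : HasDerivAt (fun t : ℝ => y + t • v) v 0 := by
    simpa using ((hasDerivAt_id (0 : ℝ)).smul_const v).const_add y
  have h1 : HasDerivAt (fun t : ℝ => mollify φ k (y + t • v)) (fderiv ℝ (mollify φ k) y v) 0 := by
    have hd' : HasFDerivAt (mollify φ k) (fderiv ℝ (mollify φ k) y) (y + (0 : ℝ) • v) := by
      simpa using hd.hasFDerivAt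
    exact hd'.comp_hasDerivAt (0 : ℝ) hlin
  have hcont : Continuous fun s : ℝ => inner ℝ v (mollify φ g (y + s • v)) :=
    continuous_const.inner (hG.comp (by fun_prop))
  have h2 : HasDerivAt (fun t : ℝ => mollify φ k (y + t • v)) (inner ℝ v (mollify φ g y)) 0 := by
    have := (intervalIntegral.integral_hasDerivAt_right (a := 0) (b := 0)
      (hcont.intervalIntegrable _ _) (hcont.stronglyMeasurableAtFilter _ _)
      hcont.continuousAt).const_add (mollify φ k y)
    simp only [zero_smul, add_zero] at this
    refine this.congr_of_eventuallyEq (Eventually.of_forall fun t => ?_)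
    have := mollify_sub_eq_intervalIntegral φ hk.measurable hA hg hB hline y v t
    simp only; linarith
  rw [h1.unique h2, real_inner_comm]

/-- A sequence of bump functions shrinking to the origin. -/
noncomputable def bumpSeq (n : ℕ) : ContDiffBump (0 : E) where
  rIn := 1 / ((n : ℝ) + 1)
  rOut := 2 / ((n : ℝ) + 1)
  rIn_pos := by positivity
  rIn_lt_rOut := by gcongr; norm_num

set_option linter.unusedSectionVars false in
theorem tendsto_bumpSeq_rOut : Tendsto (fun n => (bumpSeq (E := E) n).rOut) atTop (𝓝 0) := by
  have := (tendsto_one_div_add_atTop_nhds_zero_nat (𝕜 := ℝ)).const_mul 2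
  simpa [bumpSeq, div_eq_mul_inv] using this

theorem tendsto_mollify {k : E → ℝ} (hk : Continuous k) (y : E) :
    Tendsto (fun n => mollify (bumpSeq n) k y) atTop (𝓝 (k y)) :=
  ContDiffBump.convolution_tendsto_right tendsto_bumpSeq_rOut
    (Eventually.of_forall fun _ => hk.aestronglyMeasurable)
    ((hk.tendsto y).comp tendsto_snd) tendsto_const_nhds

/-- Lebesgue differentiation; it applies because the ratio of outer to inner radius of the bumps
stays equal to 2. -/
theorem ae_tendsto_mollify {g : E → E} (hg : Measurable g) {B : ℝ} (hB : ∀ y, ‖g y‖ ≤ B) :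
    ∀ᵐ y, Tendsto (fun n => mollify (bumpSeq n) g y) atTop (𝓝 (g y)) :=
  ContDiffBump.ae_convolution_tendsto_right_of_locallyIntegrable (K := 2) tendsto_bumpSeq_rOut
    (Eventually.of_forall fun n => by simp [bumpSeq, div_eq_mul_inv])
    (locallyIntegrable_of_bound hg hB)

/-- The derivative of a constant vanishes, for derivatives along lines in the integrated sense. -/
theorem ae_eq_zero_of_line_integral {g : E → E} (hg : Measurable g) {B : ℝ}
    (hB : ∀ y, ‖g y‖ ≤ B)
    (hline : ∀ y v t, ∫ s in (0 : ℝ)..t, inner ℝ v (g (y + s • v)) = 0) :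
    ∀ᵐ y, g y = 0 := by
  filter_upwards [ae_tendsto_mollify hg hB] with y hy
  refine tendsto_nhds_unique hy ?_
  have h1 : ∀ n, mollify (bumpSeq (E := E) n) (fun _ => (1 : ℝ)) = fun _ => 1 := fun n => by
    funext y
    simp [mollify_apply, ContDiffBump.integral_normed]
  -- By hypothesis g serves as a line gradient of the constant 1, whose mollification is again
  -- constant.
  have : ∀ n, mollify (bumpSeq n) g y = 0 := fun n => by
    rw [← gradient_mollify (bumpSeq n) (k := fun _ => (1 : ℝ)) continuous_const (A := 1)
      (by simp) hg hB (fun y v t => by rw [hline]; simp), h1]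
    simp
  simp [this]

/-- A `Φ`-Sobolev inequality extends to functions which have a bounded gradient only in the sense
of integrals along lines. -/
theorem PhiSobolev.of_line_integral {S : Set ℝ} {Φ : ℝ → ℝ} {ρ : Measure E}
    [IsProbabilityMeasure ρ] (hρ : ρ ≪ volume) {α : ℝ} (h : PhiSobolev S Φ ρ α)
    (hΦ : Continuous Φ) (hΦ2 : ContinuousOn (deriv (deriv Φ)) S) {a b : ℝ}
    (hS : Set.Icc a b ⊆ S) {k : E → ℝ} {g : E → E} (hk : Continuous k)
    (hab : ∀ y, k y ∈ Set.Icc a b) {c : ℝ} (hc : HasCompactSupport fun y => k y - c)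
    (hg : Measurable g) {B : ℝ} (hB : ∀ y, ‖g y‖ ≤ B)
    (hline : ∀ y v t, k (y + t • v) - k y = ∫ s in (0 : ℝ)..t, inner ℝ v (g (y + s • v))) :
    phiEntropy Φ ρ k ≤ α / 2 * ∫ y, deriv (deriv Φ) (k y) * ‖g y‖ ^ 2 ∂ρ := by
  have hA : ∀ y, ‖k y‖ ≤ max |a| |b| := fun y => abs_le_max_abs_abs (hab y).1 (hab y).2
  obtain ⟨M, hM⟩ := isCompact_Icc.exists_bound_of_continuousOn (hΦ.continuousOn (s := Set.Icc a b))
  obtain ⟨N, hN⟩ := isCompact_Icc.exists_bound_of_continuousOn (hΦ2.mono hS)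
  set κ : ℕ → E → ℝ := fun n => mollify (bumpSeq n) k with hκ
  have hκab : ∀ n y, κ n y ∈ Set.Icc a b := fun n => mollify_mem_Icc _ hk.measurable hab
  have hκc : ∀ n, Continuous (κ n) := fun n => (contDiff_mollify _ hk).continuous
  have hκlim : ∀ y, Tendsto (fun n => κ n y) atTop (𝓝 (k y)) := tendsto_mollify hk
  have hgc : ∀ n, Continuous (mollify (bumpSeq (E := E) n) g) := fun n =>
    HasCompactSupport.continuous_convolution_left _
      (bumpSeq n).hasCompactSupport_normed (bumpSeq n).continuous_normed
      (locallyIntegrable_of_bound hg hB)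
  have hB0 : 0 ≤ B := (norm_nonneg _).trans (hB 0)
  have hineq : ∀ n, phiEntropy Φ ρ (κ n)
      ≤ α / 2 * ∫ y, deriv (deriv Φ) (κ n y) * ‖mollify (bumpSeq n) g y‖ ^ 2 ∂ρ := fun n => by
    have := h.2 (κ n) (contDiff_mollify _ hk)
      ⟨c, hasCompactSupport_mollify_sub _ hk hc hA⟩ (fun y => hS (hκab n y))
    simpa only [hκ, gradient_mollify (bumpSeq n) hk hA hg hB hline] using this
  have hmean : Tendsto (fun n => ∫ y, κ n y ∂ρ) atTop (𝓝 (∫ y, k y ∂ρ)) :=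
    tendsto_integral_of_dominated_convergence (fun _ => max |a| |b|)
      (fun n => (hκc n).aestronglyMeasurable) (integrable_const _)
      (fun n => ae_of_all _ fun y => norm_mollify_le _ hA y) (ae_of_all _ hκlim)
  have hPhi : Tendsto (fun n => ∫ y, Φ (κ n y) ∂ρ) atTop (𝓝 (∫ y, Φ (k y) ∂ρ)) :=
    tendsto_integral_of_dominated_convergence (fun _ => M)
      (fun n => (hΦ.comp (hκc n)).aestronglyMeasurable) (integrable_const _)
      (fun n => ae_of_all _ fun y => hM _ (hκab n y))
      (ae_of_all _ fun y => (hΦ.tendsto _).comp (hκlim y))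
  have hgrad : Tendsto (fun n => ∫ y, deriv (deriv Φ) (κ n y) * ‖mollify (bumpSeq n) g y‖ ^ 2 ∂ρ)
      atTop (𝓝 (∫ y, deriv (deriv Φ) (k y) * ‖g y‖ ^ 2 ∂ρ)) := by
    refine tendsto_integral_of_dominated_convergence (fun _ => N * B ^ 2)
      (fun n => ?_) (integrable_const _) (fun n => ae_of_all _ fun y => ?_) ?_
    · exact (((measurable_deriv _).comp (hκc n).measurable).mul
        ((hgc n).norm.pow 2).measurable).aestronglyMeasurable
    · rw [norm_mul, norm_pow, norm_norm]
      have := hN _ (hκab n y)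
      exact mul_le_mul this (pow_le_pow_left₀ (norm_nonneg _) (norm_mollify_le _ hB y) 2)
        (by positivity) ((norm_nonneg _).trans this)
    -- Absolute continuity of ρ is essential here: the mollified gradients converge only
    -- Lebesgue-a.e. Since Φ'' is continuous only on S, the convergence of κ is taken within the
    -- interval [a, b].
    · filter_upwards [hρ.ae_le (ae_tendsto_mollify hg hB)] with y hy
      refine Tendsto.mul ?_ (hy.norm.pow 2)
      have h1 : Tendsto (fun n => κ n y) atTop (𝓝[Set.Icc a b] (k y)) :=
        tendsto_nhdsWithin_iff.mpr ⟨hκlim y, Eventually.of_forall fun n => hκab n y⟩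
      exact ((hΦ2.mono hS) (k y) (hab y)).tendsto.comp h1
  exact le_of_tendsto_of_tendsto' (hPhi.sub ((hΦ.tendsto _).comp hmean))
    (hgrad.const_mul (α / 2)) hineq

end Mollification


/-- The Cauchy-Schwarz inequality with a positive weight. -/
theorem sq_integral_le_weighted {Ω : Type*} [MeasurableSpace Ω] {μ : Measure Ω} {F w : Ω → ℝ}
    (hF : Integrable F μ) (hw : Integrable w μ) (hFw : Integrable (fun x => F x ^ 2 / w x) μ)
    (hpos : ∀ x, 0 < w x) :
    (∫ x, F x ∂μ) ^ 2 ≤ (∫ x, w x ∂μ) * ∫ x, F x ^ 2 / w x ∂μ := by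
  set m := ∫ x, F x ∂μ
  set W := ∫ x, w x ∂μ
  have hW0 : 0 ≤ W := integral_nonneg fun x => (hpos x).le
  rcases hW0.eq_or_lt with hW | hW
  · have h0 : w =ᵐ[μ] 0 := (integral_eq_zero_iff_of_nonneg (fun x => (hpos x).le) hw).mp hW.symm
    have hμ : μ = 0 := by
      rw [← ae_eq_bot, ← empty_mem_iff_bot]
      filter_upwards [h0] with x hx
      exact absurd hx (hpos x).ne'
    simp [m, hμ]
  -- Integrates 2cF - c²w ≤ F²/w at the optimal value c = m/W.
  · have key : ∫ x, (2 * (m / W) * F x - (m / W) ^ 2 * w x) ∂μ ≤ ∫ x, F x ^ 2 / w x ∂μ := by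
      refine integral_mono ((hF.const_mul _).sub (hw.const_mul _)) hFw fun x => ?_
      simp only
      rw [le_div_iff₀ (hpos x)]
      nlinarith [sq_nonneg (F x - m / W * w x)]
    rw [integral_sub (hF.const_mul _) (hw.const_mul _), integral_const_mul,
      integral_const_mul] at key
    have h2 : 2 * (m / W) * m - (m / W) ^ 2 * W = m ^ 2 / W := by field_simp; ring
    have h3 : m ^ 2 / W ≤ ∫ x, F x ^ 2 / w x ∂μ := by rw [← h2]; exact key
    rw [div_le_iff₀ hW] at h3
    linarith

/-! ### Conditional laws, the score, and the gradient of conditional averages -/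

section CondLaw

variable {d : ℕ} {G : Euc d → Euc d → ℝ}

theorem normConst_pos (hZ : ∀ y, Integrable (fun x => Real.exp (-G x y))) (y : Euc d) :
    0 < normConst G y := integral_exp_pos (hZ y)

theorem condDensity_pos (hZ : ∀ y, Integrable (fun x => Real.exp (-G x y))) (x y : Euc d) :
    0 < condDensity G x y := div_pos (Real.exp_pos _) (normConst_pos hZ y)

theorem measurable_condDensity (hG : Measurable (Function.uncurry G)) :
    Measurable fun z : Euc d × Euc d => condDensity G z.1 z.2 := by
  have h1 : Measurable fun z : Euc d × Euc d => Real.exp (-G z.1 z.2) :=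
    Real.measurable_exp.comp hG.neg
  have h2 : Measurable (normConst G) :=
    (StronglyMeasurable.integral_prod_left (f := fun x y => Real.exp (-G x y))
      h1.stronglyMeasurable).measurable
  exact h1.div (h2.comp measurable_snd)

theorem measurable_condDensity_left (hG : Measurable (Function.uncurry G)) (y : Euc d) :
    Measurable fun x => condDensity G x y :=
  (measurable_condDensity hG).comp (measurable_id.prodMk measurable_const)

theorem integral_condLaw {V : Type*} [NormedAddCommGroup V] [NormedSpace ℝ V]
    (hG : Measurable (Function.uncurry G)) (hZ : ∀ y, Integrable (fun x => Real.exp (-G x y)))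
    (y : Euc d) (F : Euc d → V) :
    ∫ x, F x ∂condLaw G y = ∫ x, condDensity G x y • F x := by
  rw [condLaw, integral_withDensity_eq_integral_toReal_smul
    (measurable_condDensity_left hG y).ennreal_ofReal (ae_of_all _ fun x => by simp)]
  simp only [ENNReal.toReal_ofReal (condDensity_pos hZ _ y).le]

theorem integrable_condLaw_iff {V : Type*} [NormedAddCommGroup V] [NormedSpace ℝ V]
    (hG : Measurable (Function.uncurry G)) (hZ : ∀ y, Integrable (fun x => Real.exp (-G x y)))
    (y : Euc d) {F : Euc d → V} :
    Integrable F (condLaw G y) ↔ Integrable (fun x => condDensity G x y • F x) := by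
  rw [condLaw, integrable_withDensity_iff_integrable_smul'
    (measurable_condDensity_left hG y).ennreal_ofReal (ae_of_all _ fun x => by simp)]
  simp only [ENNReal.toReal_ofReal (condDensity_pos hZ _ y).le]

theorem integrable_condDensity (hZ : ∀ y, Integrable (fun x => Real.exp (-G x y)))
    (y : Euc d) : Integrable fun x => condDensity G x y := (hZ y).div_const _

theorem integral_condDensity (hZ : ∀ y, Integrable (fun x => Real.exp (-G x y)))
    (y : Euc d) : ∫ x, condDensity G x y = 1 := by
  simp only [condDensity]
  rw [integral_div]
  exact div_self (normConst_pos hZ y).ne'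

theorem isProbabilityMeasure_condLaw
    (hZ : ∀ y, Integrable (fun x => Real.exp (-G x y))) (y : Euc d) :
    IsProbabilityMeasure (condLaw G y) := by
  constructor
  rw [condLaw, withDensity_apply _ MeasurableSet.univ, setLIntegral_univ,
    ← ofReal_integral_eq_lintegral_ofReal (integrable_condDensity hZ y)
      (ae_of_all _ fun x => (condDensity_pos hZ x y).le), integral_condDensity hZ]
  simp

theorem score_eq (hZ : ∀ y, Integrable (fun x => Real.exp (-G x y)))
    (hdiff : ∀ x, Differentiable ℝ (fun y => condDensity G x y)) (x y : Euc d) :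
    score G x y = (condDensity G x y)⁻¹ • gradient (condDensity G x) y := by
  refine ext_inner_right ℝ fun v => ?_
  rw [score, inner_gradient_left, inner_smul_left, inner_gradient_left,
    fderiv.log (hdiff x y) (condDensity_pos hZ x y).ne']
  simp

/-- Each coordinate is a limit of difference quotients along steps 1/(n+1), each jointly measurable;
no continuity in x is required. -/
theorem measurable_gradient_of_measurable {p : Euc d → Euc d → ℝ}
    (hp : Measurable fun z : Euc d × Euc d => p z.1 z.2)
    (hdiff : ∀ x, Differentiable ℝ (p x)) :
    Measurable fun z : Euc d × Euc d => gradient (p z.1) z.2 := by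
  have hcoord : ∀ (i : Fin d), Measurable fun z : Euc d × Euc d => gradient (p z.1) z.2 i := by
    intro i
    have hlim : ∀ z : Euc d × Euc d, Tendsto (fun n : ℕ => ((n : ℝ) + 1) *
        (p z.1 (z.2 + (1 / ((n : ℝ) + 1)) • EuclideanSpace.single i (1 : ℝ)) - p z.1 z.2)) atTop
        (𝓝 (gradient (p z.1) z.2 i)) := by
      intro z
      have h1 : HasLineDerivAt ℝ (p z.1) (gradient (p z.1) z.2 i) z.2
          (EuclideanSpace.single i (1 : ℝ)) := by
        have := (hdiff z.1 z.2).hasFDerivAt.hasLineDerivAt (EuclideanSpace.single i (1 : ℝ))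
        rw [← inner_gradient_left, EuclideanSpace.inner_single_right] at this
        simpa only [map_one, one_mul, mul_one, conj_trivial] using this
      have h2 := h1.tendsto_slope_zero
      have h3 : Tendsto (fun n : ℕ => 1 / ((n : ℝ) + 1)) atTop (𝓝[≠] 0) :=
        tendsto_nhdsWithin_iff.mpr ⟨tendsto_one_div_add_atTop_nhds_zero_nat,
          Eventually.of_forall fun n => by
            have : (0 : ℝ) < 1 / ((n : ℝ) + 1) := by positivity
            exact this.ne'⟩
      refine (h2.comp h3).congr fun n => ?_
      simp
    refine measurable_of_tendsto_metrizable (fun n => ?_) (tendsto_pi_nhds.mpr hlim)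
    have h1 : Measurable fun z : Euc d × Euc d =>
        p z.1 (z.2 + (1 / ((n : ℝ) + 1)) • EuclideanSpace.single i (1 : ℝ)) :=
      hp.comp (measurable_fst.prodMk (measurable_snd.add_const _))
    exact (h1.sub hp).const_mul _
  have := (WithLp.measurable_toLp 2 (Fin d → ℝ)).comp (measurable_pi_lambda _ hcoord)
  exact this

theorem measurable_score (hG : Measurable (Function.uncurry G))
    (hZ : ∀ y, Integrable (fun x => Real.exp (-G x y)))
    (hdiff : ∀ x, Differentiable ℝ (fun y => condDensity G x y)) :
    Measurable fun z : Euc d × Euc d => score G z.1 z.2 := by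
  simp only [score_eq hZ hdiff]
  exact (measurable_condDensity hG).inv.smul
    (measurable_gradient_of_measurable (measurable_condDensity hG) hdiff)

theorem measurable_score_left (hG : Measurable (Function.uncurry G))
    (hZ : ∀ y, Integrable (fun x => Real.exp (-G x y)))
    (hdiff : ∀ x, Differentiable ℝ (fun y => condDensity G x y)) (y : Euc d) :
    Measurable fun x => score G x y := by
  have h : (fun x => score G x y)
      = (fun z : Euc d × Euc d => score G z.1 z.2) ∘ fun x => (x, y) := rfl
  rw [h]
  exact (measurable_score hG hZ hdiff).comp (measurable_id.prodMk measurable_const)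

/-- Summing the criterion over an orthonormal basis makes ‖score‖² integrable, and t ≤ 1 + t². -/
theorem VarCriterion.integrable_score (hG : Measurable (Function.uncurry G))
    (hZ : ∀ y, Integrable (fun x => Real.exp (-G x y)))
    (hdiff : ∀ x, Differentiable ℝ (fun y => condDensity G x y)) {K : ℝ}
    (hV : VarCriterion G K) (y : Euc d) : Integrable (fun x => score G x y) (condLaw G y) := by
  have := isProbabilityMeasure_condLaw hZ y
  have h1 : Integrable (fun x => ∑ i, inner ℝ (EuclideanSpace.single i (1 : ℝ)) (score G x y) ^ 2)
      (condLaw G y) := integrable_finsetSum _ fun i _ => (hV _ y).1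
  refine ((integrable_const (1 : ℝ)).add h1).mono'
    (measurable_score_left hG hZ hdiff y).aestronglyMeasurable (ae_of_all _ fun x => ?_)
  have h2 : ∑ i, inner ℝ (EuclideanSpace.single i (1 : ℝ)) (score G x y) ^ 2
      = ‖score G x y‖ ^ 2 := by
    rw [EuclideanSpace.norm_sq_eq]
    simp [EuclideanSpace.inner_single_left]
  simp only [Pi.add_apply, h2]
  nlinarith [sq_nonneg (‖score G x y‖ - 1), norm_nonneg (score G x y)]

/-- Cauchy-Schwarz with weight 1. The bound is uniform in y, which is what makes Fubini along
segments possible. -/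
theorem VarCriterion.integral_abs_le (hG : Measurable (Function.uncurry G))
    (hZ : ∀ y, Integrable (fun x => Real.exp (-G x y)))
    (hdiff : ∀ x, Differentiable ℝ (fun y => condDensity G x y)) {K : ℝ}
    (hV : VarCriterion G K) (u y : Euc d) :
    ∫ x, |inner ℝ u (score G x y)| ∂condLaw G y ≤ |K| * ‖u‖ := by
  have := isProbabilityMeasure_condLaw hZ y
  have h := sq_integral_le_weighted (μ := condLaw G y) (F := fun x => |inner ℝ u (score G x y)|)
    (w := fun _ => 1) ((hV.integrable_score hG hZ hdiff y).const_inner u).abs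
    (integrable_const _) (by simpa using (hV u y).1) (by simp)
  simp only [integral_const, probReal_univ, smul_eq_mul, mul_one, one_mul, div_one,
    sq_abs] at h
  refine abs_le_of_sq_le_sq' (h.trans ((hV u y).2.trans_eq ?_)) (by positivity) |>.2
  rw [mul_pow, sq_abs]

/-- A measurable bounded family of functions, differentiable with bounded gradient in the second
variable. -/
structure BddGradient (F : Euc d → Euc d → ℝ) (M N : ℝ) : Prop where
  measurable : Measurable fun z : Euc d × Euc d => F z.1 z.2
  differentiable : ∀ x, Differentiable ℝ (F x)
  bound : ∀ x y, ‖F x y‖ ≤ M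
  gradient_bound : ∀ x y, ‖gradient (F x) y‖ ≤ N

variable (G) in
/-- The conditional expectation of `F` as a function of `y`. -/
noncomputable def condAvg (F : Euc d → Euc d → ℝ) (y : Euc d) : ℝ := ∫ x, F x y ∂condLaw G y

variable (G) in
/-- The gradient of the conditional expectation, by differentiation under the integral. -/
noncomputable def condAvgGrad (F : Euc d → Euc d → ℝ) (y : Euc d) : Euc d :=
  ∫ x, gradient (F x) y ∂condLaw G y + ∫ x, F x y • score G x y ∂condLaw G y

variable {F : Euc d → Euc d → ℝ} {M N : ℝ}

namespace BddGradient

theorem measurable_gradient (hF : BddGradient F M N) :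
    Measurable fun z : Euc d × Euc d => gradient (F z.1) z.2 :=
  measurable_gradient_of_measurable hF.measurable hF.differentiable

theorem measurable_left (hF : BddGradient F M N) (y : Euc d) : Measurable fun x => F x y :=
  hF.measurable.comp (measurable_id.prodMk measurable_const)

theorem measurable_gradient_left (hF : BddGradient F M N) (y : Euc d) :
    Measurable fun x => gradient (F x) y :=
  hF.measurable_gradient.comp (measurable_id.prodMk measurable_const)

theorem integrable (hF : BddGradient F M N)
    (hZ : ∀ y, Integrable (fun x => Real.exp (-G x y))) (y : Euc d) :
    Integrable (fun x => F x y) (condLaw G y) :=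
  have := isProbabilityMeasure_condLaw hZ y
  .of_bound (hF.measurable_left y).aestronglyMeasurable M (ae_of_all _ fun x => hF.bound x y)

theorem integrable_gradient (hF : BddGradient F M N)
    (hZ : ∀ y, Integrable (fun x => Real.exp (-G x y))) (y : Euc d) :
    Integrable (fun x => gradient (F x) y) (condLaw G y) :=
  have := isProbabilityMeasure_condLaw hZ y
  .of_bound (hF.measurable_gradient_left y).aestronglyMeasurable N
    (ae_of_all _ fun x => hF.gradient_bound x y)

theorem integrable_smul_score (hF : BddGradient F M N) (hG : Measurable (Function.uncurry G))
    (hZ : ∀ y, Integrable (fun x => Real.exp (-G x y)))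
    (hdiff : ∀ x, Differentiable ℝ (fun y => condDensity G x y)) {K : ℝ}
    (hV : VarCriterion G K) (y : Euc d) :
    Integrable (fun x => F x y • score G x y) (condLaw G y) := by
  have hs := hV.integrable_score hG hZ hdiff y
  refine (hs.norm.const_mul M).mono'
    ((hF.measurable_left y).aestronglyMeasurable.smul hs.aestronglyMeasurable)
    (ae_of_all _ fun x => ?_)
  rw [norm_smul]
  exact mul_le_mul_of_nonneg_right (hF.bound x y) (norm_nonneg _)

theorem inner_condAvgGrad (hF : BddGradient F M N) (hG : Measurable (Function.uncurry G))
    (hZ : ∀ y, Integrable (fun x => Real.exp (-G x y)))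
    (hdiff : ∀ x, Differentiable ℝ (fun y => condDensity G x y)) {K : ℝ}
    (hV : VarCriterion G K) (v y : Euc d) :
    inner ℝ v (condAvgGrad G F y) = ∫ x, (inner ℝ v (gradient (F x) y)
      + F x y * inner ℝ v (score G x y)) ∂condLaw G y := by
  have h1 : Integrable (fun x => inner ℝ v (gradient (F x) y)) (condLaw G y) :=
    (hF.integrable_gradient hZ y).const_inner v
  have h2 : Integrable (fun x => inner ℝ v (F x y • score G x y)) (condLaw G y) :=
    (hF.integrable_smul_score hG hZ hdiff hV y).const_inner v
  rw [condAvgGrad, inner_add_right, ← integral_inner (hF.integrable_gradient hZ y),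
    ← integral_inner (hF.integrable_smul_score hG hZ hdiff hV y), ← integral_add h1 h2]
  simp only [inner_smul_right]

theorem integrable_inner_condAvgGrad (hF : BddGradient F M N)
    (hG : Measurable (Function.uncurry G))
    (hZ : ∀ y, Integrable (fun x => Real.exp (-G x y)))
    (hdiff : ∀ x, Differentiable ℝ (fun y => condDensity G x y)) {K : ℝ}
    (hV : VarCriterion G K) (v y : Euc d) :
    Integrable (fun x => inner ℝ v (gradient (F x) y)
      + F x y * inner ℝ v (score G x y)) (condLaw G y) := by
  have h1 : Integrable (fun x => inner ℝ v (gradient (F x) y)) (condLaw G y) :=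
    (hF.integrable_gradient hZ y).const_inner v
  have h2 : Integrable (fun x => inner ℝ v (F x y • score G x y)) (condLaw G y) :=
    (hF.integrable_smul_score hG hZ hdiff hV y).const_inner v
  simp only [inner_smul_right] at h2
  exact h1.add h2

theorem integral_abs_inner_le (hF : BddGradient F M N) (hG : Measurable (Function.uncurry G))
    (hZ : ∀ y, Integrable (fun x => Real.exp (-G x y)))
    (hdiff : ∀ x, Differentiable ℝ (fun y => condDensity G x y)) {K : ℝ}
    (hV : VarCriterion G K) (v y : Euc d) :
    ∫ x, |inner ℝ v (gradient (F x) y) + F x y * inner ℝ v (score G x y)| ∂condLaw G y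
      ≤ (N + M * |K|) * ‖v‖ := by
  have := isProbabilityMeasure_condLaw hZ y
  have hM : 0 ≤ M := (norm_nonneg _).trans (hF.bound 0 0)
  have hint : Integrable (fun x => M * |inner ℝ v (score G x y)|) (condLaw G y) :=
    (((hV.integrable_score hG hZ hdiff y).const_inner v).abs).const_mul M
  calc ∫ x, |inner ℝ v (gradient (F x) y) + F x y * inner ℝ v (score G x y)| ∂condLaw G y
      ≤ ∫ x, (N * ‖v‖ + M * |inner ℝ v (score G x y)|) ∂condLaw G y := by
        refine integral_mono (hF.integrable_inner_condAvgGrad hG hZ hdiff hV v y).abs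
          ((integrable_const _).add hint) fun x => ?_
        refine (abs_add_le _ _).trans (add_le_add ?_ ?_)
        · refine (abs_real_inner_le_norm _ _).trans ?_
          rw [mul_comm]
          exact mul_le_mul_of_nonneg_right (hF.gradient_bound x y) (norm_nonneg _)
        · rw [abs_mul]
          exact mul_le_mul_of_nonneg_right (hF.bound x y) (abs_nonneg _)
    _ = N * ‖v‖ + M * ∫ x, |inner ℝ v (score G x y)| ∂condLaw G y := by
        rw [integral_add (integrable_const _) hint, integral_const, integral_const_mul]
        simp only [probReal_univ, one_smul]
    _ ≤ N * ‖v‖ + M * (|K| * ‖v‖) := by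
        gcongr
        exact hV.integral_abs_le hG hZ hdiff v y
    _ = _ := by ring

/-- The vector is paired with itself, which reduces the bound to the scalar estimate in one
direction. -/
theorem norm_condAvgGrad_le (hF : BddGradient F M N) (hG : Measurable (Function.uncurry G))
    (hZ : ∀ y, Integrable (fun x => Real.exp (-G x y)))
    (hdiff : ∀ x, Differentiable ℝ (fun y => condDensity G x y)) {K : ℝ}
    (hV : VarCriterion G K) (y : Euc d) : ‖condAvgGrad G F y‖ ≤ N + M * |K| := by
  set v := condAvgGrad G F y with hv
  have h1 : ‖v‖ * ‖v‖ ≤ (N + M * |K|) * ‖v‖ := by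
    calc ‖v‖ * ‖v‖ = inner ℝ v (condAvgGrad G F y) := (real_inner_self_eq_norm_mul_norm v).symm
      _ ≤ _ := by
        rw [hF.inner_condAvgGrad hG hZ hdiff hV]
        exact (le_abs_self _).trans (abs_integral_le_integral_abs.trans
          (hF.integral_abs_inner_le hG hZ hdiff hV v y))
  rcases (norm_nonneg v).eq_or_lt with h0 | h0
  · rw [← h0]
    have hM : 0 ≤ M := (norm_nonneg _).trans (hF.bound 0 0)
    have hN : 0 ≤ N := (norm_nonneg _).trans (hF.gradient_bound 0 0)
    positivity
  · exact le_of_mul_le_mul_right h1 h0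

theorem measurable_condAvgGrad (hF : BddGradient F M N) (hG : Measurable (Function.uncurry G))
    (hZ : ∀ y, Integrable (fun x => Real.exp (-G x y)))
    (hdiff : ∀ x, Differentiable ℝ (fun y => condDensity G x y)) :
    Measurable (condAvgGrad G F) := by
  have hp := measurable_condDensity hG
  have : condAvgGrad G F = fun y => (∫ x, condDensity G x y • gradient (F x) y)
      + ∫ x, condDensity G x y • (F x y • score G x y) := by
    funext y
    rw [condAvgGrad, integral_condLaw hG hZ, integral_condLaw hG hZ]
  rw [this]
  refine Measurable.add ?_ ?_
  · exact (StronglyMeasurable.integral_prod_left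
      (f := fun x y => condDensity G x y • gradient (F x) y)
      (hp.smul hF.measurable_gradient).stronglyMeasurable).measurable
  · exact (StronglyMeasurable.integral_prod_left
      (f := fun x y => condDensity G x y • (F x y • score G x y))
      (hp.smul (hF.measurable.smul (measurable_score hG hZ hdiff))).stronglyMeasurable).measurable

/-- For fixed x the product of density and F is differentiable along the segment, with derivative q.
The uniform L¹ bound makes q integrable on segment × space, so the order of integration can be
exchanged: this replaces the domination needed for differentiating under the integral. -/
theorem condAvg_sub_eq_intervalIntegral (hF : BddGradient F M N)
    (hG : Measurable (Function.uncurry G))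
    (hZ : ∀ y, Integrable (fun x => Real.exp (-G x y)))
    (hdiff : ∀ x, Differentiable ℝ (fun y => condDensity G x y)) {K : ℝ}
    (hV : VarCriterion G K) (y v : Euc d) (t : ℝ) :
    condAvg G F (y + t • v) - condAvg G F y
      = ∫ s in (0 : ℝ)..t, inner ℝ v (condAvgGrad G F (y + s • v)) := by
  set q : ℝ → Euc d → ℝ := fun s x => condDensity G x (y + s • v) *
    (inner ℝ v (gradient (F x) (y + s • v)) + F x (y + s • v) * inner ℝ v (score G x (y + s • v)))
    with hq
  have hqm : Measurable (Function.uncurry q) := by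
    have hpath : Measurable fun z : ℝ × Euc d => (z.2, y + z.1 • v) := by fun_prop
    have h1 := (measurable_condDensity hG).comp hpath
    have h2 := hF.measurable.comp hpath
    have h3 := (hF.measurable_gradient.comp hpath).const_inner (𝕜 := ℝ) (c := v)
    have h4 := ((measurable_score hG hZ hdiff).comp hpath).const_inner (𝕜 := ℝ) (c := v)
    exact h1.mul (h3.add (h2.mul h4))
  have hqi : ∀ s, Integrable (q s) := fun s =>
    (integrable_condLaw_iff hG hZ _).mp (hF.integrable_inner_condAvgGrad hG hZ hdiff hV v _)
  have hqint : Integrable (Function.uncurry q)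
      ((volume.restrict (Set.uIoc 0 t)).prod volume) := by
    rw [integrable_prod_iff hqm.aestronglyMeasurable]
    refine ⟨ae_of_all _ hqi, ?_⟩
    have hfin : IsFiniteMeasure ((volume : Measure ℝ).restrict (Set.uIoc 0 t)) :=
      ⟨by simp⟩
    refine Integrable.of_bound (C := (N + M * |K|) * ‖v‖) ?_ (ae_of_all _ fun s => ?_)
    · exact hqm.norm.stronglyMeasurable.integral_prod_right'.aestronglyMeasurable
    · rw [Real.norm_of_nonneg (integral_nonneg fun _ => norm_nonneg _)]
      refine le_trans (le_of_eq ?_) (hF.integral_abs_inner_le hG hZ hdiff hV v (y + s • v))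
      rw [integral_condLaw hG hZ]
      simp only [Function.uncurry_apply_pair, hq, norm_mul, smul_eq_mul, Real.norm_eq_abs,
        abs_of_pos (condDensity_pos hZ _ _)]
  have hinner : ∀ s : ℝ, inner ℝ v (condAvgGrad G F (y + s • v)) = ∫ x, q s x := fun s => by
    rw [hF.inner_condAvgGrad hG hZ hdiff hV, integral_condLaw hG hZ]
    rfl
  have hderiv : ∀ x s, HasDerivAt
      (fun s : ℝ => condDensity G x (y + s • v) * F x (y + s • v)) (q s x) s := by
    intro x s
    have hl : HasDerivAt (fun s : ℝ => y + s • v) v s := by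
      simpa using ((hasDerivAt_id s).smul_const v).const_add y
    have h1 := (hdiff x (y + s • v)).hasFDerivAt.comp_hasDerivAt s hl
    have h2 := (hF.differentiable x (y + s • v)).hasFDerivAt.comp_hasDerivAt s hl
    refine (h1.mul h2).congr_deriv ?_
    rw [← inner_gradient_left, ← inner_gradient_left]
    simp only [hq, score_eq hZ hdiff, inner_smul_right, Function.comp]
    rw [real_inner_comm v, real_inner_comm v]
    have := (condDensity_pos hZ x (y + s • v)).ne'
    field_simp
    ring
  -- The derivative exists everywhere but need not be continuous; its integrability on the segment,
  -- known for a.e. x by Fubini, suffices.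
  have hftc : ∀ᵐ x, ∫ s in (0 : ℝ)..t, q s x
      = condDensity G x (y + t • v) * F x (y + t • v) - condDensity G x y * F x y := by
    filter_upwards [hqint.prod_left_ae] with x hx
    rw [intervalIntegral.integral_eq_sub_of_hasDerivAt (fun s _ => hderiv x s)
      (intervalIntegrable_iff.mpr hx)]
    simp
  simp only [hinner]
  have hi : ∀ y, Integrable fun x => condDensity G x y * F x y := fun y =>
    (integrable_condLaw_iff hG hZ _).mp (hF.integrable hZ y)
  rw [intervalIntegral_integral_swap hqint, integral_congr_ae hftc,
    integral_sub (hi _) (hi _), condAvg, condAvg,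
    integral_condLaw hG hZ, integral_condLaw hG hZ]
  rfl

/-- The bounded gradient, integrated along a segment, makes the conditional average Lipschitz. -/
theorem continuous_condAvg (hF : BddGradient F M N) (hG : Measurable (Function.uncurry G))
    (hZ : ∀ y, Integrable (fun x => Real.exp (-G x y)))
    (hdiff : ∀ x, Differentiable ℝ (fun y => condDensity G x y)) {K : ℝ}
    (hV : VarCriterion G K) : Continuous (condAvg G F) := by
  have hM : 0 ≤ M := (norm_nonneg _).trans (hF.bound 0 0)
  have hN : 0 ≤ N := (norm_nonneg _).trans (hF.gradient_bound 0 0)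
  have hB : 0 ≤ N + M * |K| := by positivity
  refine (LipschitzWith.of_dist_le_mul (K := ⟨N + M * |K|, hB⟩) fun y z => ?_).continuous
  have h := hF.condAvg_sub_eq_intervalIntegral hG hZ hdiff hV z (y - z) 1
  rw [one_smul, add_sub_cancel] at h
  rw [Real.dist_eq, h, dist_eq_norm]
  have := intervalIntegral.norm_integral_le_of_norm_le_const (a := (0 : ℝ)) (b := 1)
    (f := fun s : ℝ => inner ℝ (y - z) (condAvgGrad G F (z + s • (y - z))))
    (C := (N + M * |K|) * ‖y - z‖) fun s _ => by
      refine (norm_inner_le_norm _ _).trans ?_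
      rw [mul_comm]
      exact mul_le_mul_of_nonneg_right (hF.norm_condAvgGrad_le hG hZ hdiff hV _) (norm_nonneg _)
  rw [sub_zero, abs_one, mul_one] at this
  exact this

end BddGradient

/-- The mean score is the formal gradient of the conditional average of 1, which is constant.
Knowing only integrals along lines, this gives zero for almost every y, which is enough for ρ ≪
volume. -/
theorem VarCriterion.ae_integral_score_eq_zero (hG : Measurable (Function.uncurry G))
    (hZ : ∀ y, Integrable (fun x => Real.exp (-G x y)))
    (hdiff : ∀ x, Differentiable ℝ (fun y => condDensity G x y)) {K : ℝ}
    (hV : VarCriterion G K) : ∀ᵐ y, ∫ x, score G x y ∂condLaw G y = 0 := by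
  have hF : BddGradient (fun _ _ : Euc d => (1 : ℝ)) 1 0 :=
    ⟨measurable_const, fun x => differentiable_const _, by simp, by simp⟩
  have h1 : ∀ y, condAvg G (fun _ _ => (1 : ℝ)) y = 1 := fun y => by
    have := isProbabilityMeasure_condLaw hZ y
    simp [condAvg]
  have h2 := ae_eq_zero_of_line_integral (hF.measurable_condAvgGrad hG hZ hdiff)
    (hF.norm_condAvgGrad_le hG hZ hdiff hV) fun y v t => by
      rw [← hF.condAvg_sub_eq_intervalIntegral hG hZ hdiff hV, h1, h1, sub_self]
  filter_upwards [h2] with y hy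
  simpa [condAvgGrad] using hy

end CondLaw


/-! ### Disintegration of the joint law -/

section JointLaw

variable {d : ℕ} {G : Euc d → Euc d → ℝ} {ρ : Measure (Euc d)} [IsProbabilityMeasure ρ]

theorem isProbabilityMeasure_jointLaw (hG : Measurable (Function.uncurry G))
    (hZ : ∀ y, Integrable (fun x => Real.exp (-G x y))) :
    IsProbabilityMeasure (jointLaw G ρ) := by
  have hm := (measurable_condDensity hG).ennreal_ofReal
  have : IsProbabilityMeasure (((volume : Measure (Euc d)).prod ρ).withDensity
      fun z => ENNReal.ofReal (condDensity G z.1 z.2)) := by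
    constructor
    rw [withDensity_apply _ MeasurableSet.univ, setLIntegral_univ,
      lintegral_prod_symm _ hm.aemeasurable]
    have h1 : ∀ y, ∫⁻ x, ENNReal.ofReal (condDensity G x y) = 1 := fun y => by
      rw [← ofReal_integral_eq_lintegral_ofReal (integrable_condDensity hZ y)
        (ae_of_all _ fun x => (condDensity_pos hZ x y).le), integral_condDensity hZ]
      simp
    simp [h1]
  exact Measure.isProbabilityMeasure_map (WithLp.measurable_toLp 2 _).aemeasurable

theorem integral_jointLaw (hG : Measurable (Function.uncurry G))
    (hZ : ∀ y, Integrable (fun x => Real.exp (-G x y))) {H : EucProd d → ℝ}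
    (hH : Integrable H (jointLaw G ρ)) :
    ∫ z, H z ∂jointLaw G ρ = ∫ y, condAvg G (fun x y => H (WithLp.toLp 2 (x, y))) y ∂ρ := by
  have hm := (measurable_condDensity hG).ennreal_ofReal
  have hlp : AEMeasurable (WithLp.toLp 2) (((volume : Measure (Euc d)).prod ρ).withDensity
      fun z => ENNReal.ofReal (condDensity G z.1 z.2)) :=
    (WithLp.measurable_toLp 2 _).aemeasurable
  have h1 := (integrable_map_measure hH.aestronglyMeasurable hlp).mp hH
  rw [integrable_withDensity_iff_integrable_smul' hm (ae_of_all _ fun x => by simp)] at h1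
  simp only [Function.comp] at h1
  rw [jointLaw, integral_map hlp hH.aestronglyMeasurable,
    integral_withDensity_eq_integral_toReal_smul hm (ae_of_all _ fun x => by simp),
    integral_prod_symm _ h1]
  simp only [condAvg, integral_condLaw hG hZ, ENNReal.toReal_ofReal (condDensity_pos hZ _ _).le]

theorem measurable_condAvg (hG : Measurable (Function.uncurry G))
    (hZ : ∀ y, Integrable (fun x => Real.exp (-G x y))) {H : Euc d → Euc d → ℝ}
    (hH : Measurable fun z : Euc d × Euc d => H z.1 z.2) : Measurable (condAvg G H) := by
  have : condAvg G H = fun y => ∫ x, condDensity G x y * H x y :=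
    funext fun y => integral_condLaw hG hZ y _
  rw [this]
  exact (StronglyMeasurable.integral_prod_left
      (f := fun x y => condDensity G x y * H x y)
      ((measurable_condDensity hG).mul hH).stronglyMeasurable).measurable

theorem norm_condAvg_le (hZ : ∀ y, Integrable (fun x => Real.exp (-G x y)))
    {H : Euc d → Euc d → ℝ} {M : ℝ} (hM : ∀ x y, ‖H x y‖ ≤ M) (y : Euc d) :
    ‖condAvg G H y‖ ≤ M := by
  have := isProbabilityMeasure_condLaw hZ y
  have h := norm_integral_le_of_norm_le_const (μ := condLaw G y) (ae_of_all _ fun x => hM x y)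
  rwa [probReal_univ, mul_one] at h

theorem integrable_condLaw_of_bound (hZ : ∀ y, Integrable (fun x => Real.exp (-G x y)))
    {H : Euc d → Euc d → ℝ}
    (hH : Measurable fun z : Euc d × Euc d => H z.1 z.2) {M : ℝ} (hM : ∀ x y, ‖H x y‖ ≤ M)
    (y : Euc d) : Integrable (fun x => H x y) (condLaw G y) :=
  have := isProbabilityMeasure_condLaw hZ y
  .of_bound (hH.comp (measurable_id.prodMk measurable_const)).aestronglyMeasurable M
    (ae_of_all _ fun x => hM x y)

theorem integrable_condAvg (hG : Measurable (Function.uncurry G))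
    (hZ : ∀ y, Integrable (fun x => Real.exp (-G x y))) {H : Euc d → Euc d → ℝ}
    (hH : Measurable fun z : Euc d × Euc d => H z.1 z.2) {M : ℝ} (hM : ∀ x y, ‖H x y‖ ≤ M) :
    Integrable (condAvg G H) ρ :=
  .of_bound (measurable_condAvg hG hZ hH).aestronglyMeasurable M
    (ae_of_all _ fun y => norm_condAvg_le hZ hM y)

end JointLaw

/-! ### Slices of test functions and their partial gradients -/

section Slices

variable {d : ℕ} {f : EucProd d → ℝ}

theorem contDiff_toLp_left (y : Euc d) :
    ContDiff ℝ ∞ fun x : Euc d => (WithLp.toLp 2 (x, y) : EucProd d) :=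
  (WithLp.prodContinuousLinearEquiv 2 ℝ (Euc d) (Euc d)).symm.contDiff.comp
    (contDiff_id.prodMk contDiff_const)

theorem contDiff_toLp_right (x : Euc d) :
    ContDiff ℝ ∞ fun y : Euc d => (WithLp.toLp 2 (x, y) : EucProd d) :=
  (WithLp.prodContinuousLinearEquiv 2 ℝ (Euc d) (Euc d)).symm.contDiff.comp
    (contDiff_const.prodMk contDiff_id)

theorem continuous_toLp_pair :
    Continuous fun z : Euc d × Euc d => (WithLp.toLp 2 (z.1, z.2) : EucProd d) :=
  (WithLp.prodContinuousLinearEquiv 2 ℝ (Euc d) (Euc d)).symm.continuous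

theorem gradient_slice_left (hf : Differentiable ℝ f) (x y : Euc d) :
    gradient (fun x => f (WithLp.toLp 2 (x, y))) x = (gradient f (WithLp.toLp 2 (x, y))).fst := by
  refine ext_inner_right ℝ fun v => ?_
  have h1 : HasFDerivAt (fun x : Euc d => (WithLp.toLp 2 (x, y) : EucProd d))
      (((WithLp.prodContinuousLinearEquiv 2 ℝ (Euc d) (Euc d)).symm :
        Euc d × Euc d →L[ℝ] EucProd d).comp (ContinuousLinearMap.inl ℝ (Euc d) (Euc d))) x :=
    (WithLp.prodContinuousLinearEquiv 2 ℝ (Euc d) (Euc d)).symm.hasFDerivAt.comp x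
      (hasFDerivAt_prodMk_left x y)
  have h2 := (hf (WithLp.toLp 2 (x, y))).hasFDerivAt.comp x h1
  have h3 : inner ℝ (gradient f (WithLp.toLp 2 (x, y))).fst v
      = inner ℝ (gradient f (WithLp.toLp 2 (x, y))) (WithLp.toLp 2 (v, 0) : EucProd d) := by
    rw [WithLp.prod_inner_apply]; simp
  rw [h3, inner_gradient_left, inner_gradient_left]
  exact congrArg (fun T => T v) h2.fderiv

theorem gradient_slice_right (hf : Differentiable ℝ f) (x y : Euc d) :
    gradient (fun y => f (WithLp.toLp 2 (x, y))) y = (gradient f (WithLp.toLp 2 (x, y))).snd := by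
  refine ext_inner_right ℝ fun v => ?_
  have h1 : HasFDerivAt (fun y : Euc d => (WithLp.toLp 2 (x, y) : EucProd d))
      (((WithLp.prodContinuousLinearEquiv 2 ℝ (Euc d) (Euc d)).symm :
        Euc d × Euc d →L[ℝ] EucProd d).comp (ContinuousLinearMap.inr ℝ (Euc d) (Euc d))) y :=
    (WithLp.prodContinuousLinearEquiv 2 ℝ (Euc d) (Euc d)).symm.hasFDerivAt.comp y
      (hasFDerivAt_prodMk_right x y)
  have h2 := (hf (WithLp.toLp 2 (x, y))).hasFDerivAt.comp y h1
  have h3 : inner ℝ (gradient f (WithLp.toLp 2 (x, y))).snd v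
      = inner ℝ (gradient f (WithLp.toLp 2 (x, y))) (WithLp.toLp 2 (0, v) : EucProd d) := by
    rw [WithLp.prod_inner_apply]; simp
  rw [h3, inner_gradient_left, inner_gradient_left]
  exact congrArg (fun T => T v) h2.fderiv

theorem norm_gradient_eq {E : Type*} [NormedAddCommGroup E] [InnerProductSpace ℝ E]
    [CompleteSpace E] (f : E → ℝ) (z : E) : ‖gradient f z‖ = ‖fderiv ℝ f z‖ := by
  simp [gradient]

theorem continuous_gradient {E : Type*} [NormedAddCommGroup E] [InnerProductSpace ℝ E]
    [CompleteSpace E] {f : E → ℝ} (hf : ContDiff ℝ ∞ f) : Continuous (gradient f) :=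
  (InnerProductSpace.toDual ℝ E).symm.continuous.comp (hf.continuous_fderiv (by simp))

theorem exists_bound_gradient {E : Type*} [NormedAddCommGroup E] [InnerProductSpace ℝ E]
    [CompleteSpace E] {f : E → ℝ} (hf : ContDiff ℝ ∞ f) {c : ℝ}
    (hc : HasCompactSupport fun z => f z - c) : ∃ N, ∀ z, ‖gradient f z‖ ≤ N := by
  obtain ⟨N, hN⟩ := (hc.fderiv ℝ).exists_bound_of_continuous
    ((hf.sub contDiff_const).continuous_fderiv (by simp))
  refine ⟨N, fun z => ?_⟩
  have := hN z
  rwa [fderiv_sub_const, ← norm_gradient_eq] at this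

theorem exists_compact_of_hasCompactSupport_sub {c : ℝ}
    (hc : HasCompactSupport fun z => f z - c) :
    ∃ K : Set (EucProd d), IsCompact K ∧ ∀ z ∉ K, f z = c :=
  ⟨_, hc, fun z hz => by
    have := image_eq_zero_of_notMem_tsupport hz
    linarith⟩

theorem hasCompactSupport_slice_left {c : ℝ} (hc : HasCompactSupport fun z => f z - c)
    (y : Euc d) : HasCompactSupport fun x => f (WithLp.toLp 2 (x, y)) - c := by
  obtain ⟨K, hK, hKc⟩ := exists_compact_of_hasCompactSupport_sub hc
  refine HasCompactSupport.intro (hK.image (WithLp.prod_continuous_ofLp 2 (Euc d) (Euc d)).fst)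
    fun x hx => ?_
  rw [hKc _ fun h => hx ⟨_, h, rfl⟩, sub_self]

theorem hasCompactSupport_condAvg_sub {G : Euc d → Euc d → ℝ}
    (hZ : ∀ y, Integrable (fun x => Real.exp (-G x y))) {c : ℝ}
    (hc : HasCompactSupport fun z => f z - c) :
    HasCompactSupport fun y => condAvg G (fun x y => f (WithLp.toLp 2 (x, y))) y - c := by
  obtain ⟨K, hK, hKc⟩ := exists_compact_of_hasCompactSupport_sub hc
  refine HasCompactSupport.intro (hK.image (WithLp.prod_continuous_ofLp 2 (Euc d) (Euc d)).snd)
    fun y hy => ?_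
  have := isProbabilityMeasure_condLaw hZ y
  have h : ∀ x, f (WithLp.toLp 2 (x, y)) = c := fun x => hKc _ fun h => hy ⟨_, h, rfl⟩
  simp [condAvg, h]

theorem bddGradient_slice (hf : ContDiff ℝ ∞ f) {M N : ℝ} (hM : ∀ z, ‖f z‖ ≤ M)
    (hN : ∀ z, ‖gradient f z‖ ≤ N) :
    BddGradient (fun x y => f (WithLp.toLp 2 (x, y))) M N where
  measurable := (hf.continuous.comp continuous_toLp_pair).measurable
  differentiable x := (hf.comp (contDiff_toLp_right x)).differentiable (by simp)
  bound _ _ := hM _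
  gradient_bound x y := by
    rw [gradient_slice_right (hf.differentiable (by simp))]
    exact (WithLp.norm_snd_le _ _).trans (hN _)

end Slices

/-! ### The two-scale entropy estimate -/

section TwoScaleInequality

variable {d : ℕ} {G : Euc d → Euc d → ℝ} {ρ : Measure (Euc d)} [IsProbabilityMeasure ρ]

/-- The two-scale argument: the `Φ`-entropy of the joint law is split into the averaged
conditional entropies and the entropy of the conditional expectation. -/
theorem phiEntropy_jointLaw_le (hρ : ρ ≪ volume) (hG : Measurable (Function.uncurry G))
    (hZ : ∀ y, Integrable (fun x => Real.exp (-G x y)))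
    (hdiff : ∀ x, Differentiable ℝ (fun y => condDensity G x y))
    {K : ℝ} (hV : VarCriterion G K) {S : Set ℝ} {Φ : ℝ → ℝ} {α β L C : ℝ}
    (hα : PhiSobolev S Φ ρ α) (hβ : ∀ y, PhiSobolev S Φ (condLaw G y) β)
    (hΦ : Continuous Φ) (hΦ2 : ContinuousOn (deriv (deriv Φ)) S)
    (hΦ2_nonneg : ∀ t ∈ S, 0 ≤ deriv (deriv Φ) t) {a b : ℝ} (hS : Set.Icc a b ⊆ S)
    {f : EucProd d → ℝ} (hf : ContDiff ℝ ∞ f) {c : ℝ} (hc : HasCompactSupport fun z => f z - c)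
    (hab : ∀ z, f z ∈ Set.Icc a b)
    (hbound : ∀ᵐ y ∂ρ, deriv (deriv Φ) (condAvg G (fun x y => f (WithLp.toLp 2 (x, y))) y) *
        ‖condAvgGrad G (fun x y => f (WithLp.toLp 2 (x, y))) y‖ ^ 2
      ≤ (1 + C) * condAvg G (fun x y => deriv (deriv Φ) (f (WithLp.toLp 2 (x, y))) *
          ‖gradient (fun y => f (WithLp.toLp 2 (x, y))) y‖ ^ 2) y
        + (1 + C⁻¹) * L ^ 2 * β * condAvg G (fun x y => deriv (deriv Φ) (f (WithLp.toLp 2 (x, y))) *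
          ‖gradient (fun x => f (WithLp.toLp 2 (x, y))) x‖ ^ 2) y) :
    phiEntropy Φ (jointLaw G ρ) f ≤ max (β + α * (1 + C⁻¹) * L ^ 2 * β) (α * (1 + C)) / 2 *
      ∫ z, deriv (deriv Φ) (f z) * ‖gradient f z‖ ^ 2 ∂jointLaw G ρ := by
  have := isProbabilityMeasure_jointLaw (ρ := ρ) hG hZ
  have hα0 := hα.1
  have hfd : Differentiable ℝ f := hf.differentiable (by simp)
  have hfM : ∀ z, ‖f z‖ ≤ max |a| |b| := fun z => abs_le_max_abs_abs (hab z).1 (hab z).2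
  obtain ⟨N, hN⟩ := exists_bound_gradient hf hc
  obtain ⟨P, hP⟩ := isCompact_Icc.exists_bound_of_continuousOn (hΦ.continuousOn (s := Set.Icc a b))
  obtain ⟨Q, hQ⟩ := isCompact_Icc.exists_bound_of_continuousOn (hΦ2.mono hS)
  have hF := bddGradient_slice hf hfM hN
  set F : Euc d → Euc d → ℝ := fun x y => f (WithLp.toLp 2 (x, y)) with hFdef
  set k := condAvg G F with hk
  have hkab : ∀ y, k y ∈ Set.Icc a b := fun y => by
    have := isProbabilityMeasure_condLaw hZ y
    have h1 := hF.integrable hZ y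
    constructor
    · have := integral_mono (integrable_const a) h1 fun x => (hab _).1
      rwa [integral_const, probReal_univ, one_smul] at this
    · have := integral_mono h1 (integrable_const b) fun x => (hab _).2
      rwa [integral_const, probReal_univ, one_smul] at this
  have hD2m : Measurable (deriv (deriv Φ)) := measurable_deriv _
  have hgm : Measurable fun z : Euc d × Euc d => gradient f (WithLp.toLp 2 (z.1, z.2)) :=
    ((continuous_gradient hf).comp continuous_toLp_pair).measurable
  set A : Euc d → Euc d → ℝ := fun x y => deriv (deriv Φ) (f (WithLp.toLp 2 (x, y))) *
    ‖gradient (fun y => f (WithLp.toLp 2 (x, y))) y‖ ^ 2 with hA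
  set B : Euc d → Euc d → ℝ := fun x y => deriv (deriv Φ) (f (WithLp.toLp 2 (x, y))) *
    ‖gradient (fun x => f (WithLp.toLp 2 (x, y))) x‖ ^ 2 with hB
  have hDb : ∀ z (r : ℝ), 0 ≤ r → r ≤ N → ‖deriv (deriv Φ) (f z) * r ^ 2‖ ≤ Q * N ^ 2 := by
    intro z r hr hrN
    rw [norm_mul, norm_pow, Real.norm_of_nonneg hr]
    have := hQ _ (hab z)
    exact mul_le_mul this (pow_le_pow_left₀ hr hrN 2) (by positivity) ((norm_nonneg _).trans this)
  have hAm : Measurable fun z : Euc d × Euc d => A z.1 z.2 := by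
    simp only [hA, gradient_slice_right hfd]
    exact (hD2m.comp hF.measurable).mul
      (((WithLp.prod_continuous_ofLp 2 (Euc d) (Euc d)).snd.measurable.comp hgm).norm.pow_const 2)
  have hBm : Measurable fun z : Euc d × Euc d => B z.1 z.2 := by
    simp only [hB, gradient_slice_left hfd]
    exact (hD2m.comp hF.measurable).mul
      (((WithLp.prod_continuous_ofLp 2 (Euc d) (Euc d)).fst.measurable.comp hgm).norm.pow_const 2)
  have hAb : ∀ x y, ‖A x y‖ ≤ Q * N ^ 2 := fun x y => by
    simp only [hA, gradient_slice_right hfd]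
    exact hDb _ _ (norm_nonneg _) ((WithLp.norm_snd_le _ _).trans (hN _))
  have hBb : ∀ x y, ‖B x y‖ ≤ Q * N ^ 2 := fun x y => by
    simp only [hB, gradient_slice_left hfd]
    exact hDb _ _ (norm_nonneg _) ((WithLp.norm_fst_le _ _).trans (hN _))
  have hA0 : ∀ y, 0 ≤ condAvg G A y := fun y =>
    integral_nonneg fun x => mul_nonneg (hΦ2_nonneg _ (hS (hab _))) (by positivity)
  have hB0 : ∀ y, 0 ≤ condAvg G B y := fun y =>
    integral_nonneg fun x => mul_nonneg (hΦ2_nonneg _ (hS (hab _))) (by positivity)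
  have hAi : Integrable (condAvg G A) ρ := integrable_condAvg hG hZ hAm hAb
  have hBi : Integrable (condAvg G B) ρ := integrable_condAvg hG hZ hBm hBb
  have hΦm : Measurable fun z : Euc d × Euc d => Φ (F z.1 z.2) := hΦ.measurable.comp hF.measurable
  have hΦi : Integrable (condAvg G fun x y => Φ (F x y)) ρ :=
    integrable_condAvg hG hZ hΦm (M := P) fun x y => hP _ (hab _)
  have hkc : Continuous k := hF.continuous_condAvg hG hZ hdiff hV
  have hΦki : Integrable (fun y => Φ (k y)) ρ :=
    .of_bound (hΦ.comp hkc).aestronglyMeasurable P (ae_of_all _ fun y => hP _ (hkab y))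
  -- the energy of the joint law
  have henergy : ∫ z, deriv (deriv Φ) (f z) * ‖gradient f z‖ ^ 2 ∂jointLaw G ρ
      = ∫ y, condAvg G A y ∂ρ + ∫ y, condAvg G B y ∂ρ := by
    rw [integral_jointLaw hG hZ, ← integral_add hAi hBi]
    · refine integral_congr_ae (ae_of_all _ fun y => ?_)
      simp only [condAvg]
      rw [← integral_add (integrable_condLaw_of_bound hZ hAm hAb y)
        (integrable_condLaw_of_bound hZ hBm hBb y)]
      refine integral_congr_ae (ae_of_all _ fun x => ?_)
      simp only [hA, hB, gradient_slice_left hfd, gradient_slice_right hfd]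
      rw [WithLp.prod_norm_sq_eq_of_L2]
      ring
    · refine .of_bound ?_ (Q * N ^ 2) (ae_of_all _ fun z => hDb _ _ (norm_nonneg _) (hN z))
      exact ((hD2m.comp hf.continuous.measurable).mul
        ((continuous_gradient hf).norm.pow 2).measurable).aestronglyMeasurable
  -- the decomposition of the entropy
  have hsplit : phiEntropy Φ (jointLaw G ρ) f
      = ∫ y, phiEntropy Φ (condLaw G y) (fun x => F x y) ∂ρ + phiEntropy Φ ρ k := by
    have h1 : ∫ z, Φ (f z) ∂jointLaw G ρ = ∫ y, condAvg G (fun x y => Φ (F x y)) y ∂ρ :=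
      integral_jointLaw hG hZ (.of_bound (hΦ.comp hf.continuous).aestronglyMeasurable P
        (ae_of_all _ fun z => hP _ (hab z)))
    have h2 : ∫ z, f z ∂jointLaw G ρ = ∫ y, k y ∂ρ :=
      integral_jointLaw hG hZ (.of_bound hf.continuous.aestronglyMeasurable _
        (ae_of_all _ hfM))
    have h3 : ∫ y, phiEntropy Φ (condLaw G y) (fun x => F x y) ∂ρ
        = ∫ y, condAvg G (fun x y => Φ (F x y)) y ∂ρ - ∫ y, Φ (k y) ∂ρ :=
      integral_sub hΦi hΦki
    rw [h3, phiEntropy, phiEntropy, h1, h2]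
    ring
  have hcond : ∫ y, phiEntropy Φ (condLaw G y) (fun x => F x y) ∂ρ
      ≤ β / 2 * ∫ y, condAvg G B y ∂ρ := by
    rw [← integral_const_mul]
    refine integral_mono (hΦi.sub hΦki) (hBi.const_mul _) fun y => ?_
    exact (hβ y).2 _ (hf.comp (contDiff_toLp_left y)) ⟨c, hasCompactSupport_slice_left hc y⟩
      fun x => hS (hab _)
  -- The constant K of the variance criterion is used only for regularity of k and boundedness of
  -- its gradient; the final constant sees only L, through `hbound`. So K may be far from sharp.
  have hmarg : phiEntropy Φ ρ k ≤ α / 2 * ((1 + C) * ∫ y, condAvg G A y ∂ρ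
      + (1 + C⁻¹) * L ^ 2 * β * ∫ y, condAvg G B y ∂ρ) := by
    refine (hα.of_line_integral hρ hΦ hΦ2 hS hkc hkab (hasCompactSupport_condAvg_sub hZ hc)
      (hF.measurable_condAvgGrad hG hZ hdiff) (hF.norm_condAvgGrad_le hG hZ hdiff hV)
      (hF.condAvg_sub_eq_intervalIntegral hG hZ hdiff hV)).trans ?_
    refine mul_le_mul_of_nonneg_left ?_ (by positivity)
    rw [← integral_const_mul, ← integral_const_mul,
      ← integral_add (hAi.const_mul _) (hBi.const_mul _)]
    refine integral_mono_of_nonneg (ae_of_all _ fun y => ?_)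
      ((hAi.const_mul _).add (hBi.const_mul _)) hbound
    exact mul_nonneg (hΦ2_nonneg _ (hS (hkab y))) (by positivity)
  rw [hsplit, henergy]
  have hIA : 0 ≤ ∫ y, condAvg G A y ∂ρ := integral_nonneg hA0
  have hIB : 0 ≤ ∫ y, condAvg G B y ∂ρ := integral_nonneg hB0
  -- The x-energy has collected the first term of the maximum and the y-energy the second, each
  -- halved.
  have h1 := mul_le_mul_of_nonneg_right
    (le_max_left (β + α * (1 + C⁻¹) * L ^ 2 * β) (α * (1 + C))) hIB
  have h2 := mul_le_mul_of_nonneg_right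
    (le_max_right (β + α * (1 + C⁻¹) * L ^ 2 * β) (α * (1 + C))) hIA
  nlinarith [hcond, hmarg]

theorem le_zeta_mul {α β L I e : ℝ} (hI : 0 ≤ I)
    (h : ∀ C : ℝ, 0 < C → e ≤ max (β + α * (1 + C⁻¹) * L ^ 2 * β) (α * (1 + C)) * I) :
    e ≤ zeta α β L * I := by
  have : Nonempty (Set.Ioi (0 : ℝ)) := ⟨⟨1, by simp⟩⟩
  rw [zeta, Real.iInf_mul_of_nonneg hI]
  exact le_ciInf fun C => h C C.2

/-- Young's inequality 2‖u‖‖v‖ ≤ C‖u‖² + C⁻¹‖v‖²; this is where the parameter C of ζ originates. -/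
theorem norm_add_sq_le_of_pos {E : Type*} [SeminormedAddCommGroup E]
    {C : ℝ} (hC : 0 < C) (u v : E) :
    ‖u + v‖ ^ 2 ≤ (1 + C) * ‖u‖ ^ 2 + (1 + C⁻¹) * ‖v‖ ^ 2 := by
  have h1 : ‖u + v‖ ^ 2 ≤ (‖u‖ + ‖v‖) ^ 2 :=
    pow_le_pow_left₀ (norm_nonneg _) (norm_add_le u v) 2
  have h2 : 0 ≤ C⁻¹ * (C * ‖u‖ - ‖v‖) ^ 2 := by positivity
  have h3 : C⁻¹ * (C * ‖u‖ - ‖v‖) ^ 2 = C * ‖u‖ ^ 2 - 2 * ‖u‖ * ‖v‖ + C⁻¹ * ‖v‖ ^ 2 := by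
    field_simp
    ring
  linarith

end TwoScaleInequality


/-! ### Bounds for the covariance with the score -/

theorem sq_integral_mul_le {Ω : Type*} [MeasurableSpace Ω] {μ : Measure Ω} {f g : Ω → ℝ}
    (hf : Integrable (fun x => f x ^ 2) μ) (hg : Integrable (fun x => g x ^ 2) μ)
    (hfg : Integrable (fun x => f x * g x) μ) :
    (∫ x, f x * g x ∂μ) ^ 2 ≤ (∫ x, f x ^ 2 ∂μ) * ∫ x, g x ^ 2 ∂μ := by
  have h : ∀ t : ℝ, 0 ≤ (∫ x, g x ^ 2 ∂μ) * (t * t) + (2 * ∫ x, f x * g x ∂μ) * t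
      + ∫ x, f x ^ 2 ∂μ := fun t => by
    have h0 : 0 ≤ ∫ x, ((t * t) * g x ^ 2 + (2 * t) * (f x * g x) + f x ^ 2) ∂μ :=
      integral_nonneg fun x => by
        have : (t * t) * g x ^ 2 + (2 * t) * (f x * g x) + f x ^ 2 = (t * g x + f x) ^ 2 := by
          ring
        simp only [this]
        positivity
    have hi : Integrable (fun x => (t * t) * g x ^ 2 + (2 * t) * (f x * g x)) μ :=
      (hg.const_mul _).add (hfg.const_mul _)
    rw [integral_add hi hf,
      integral_add (hg.const_mul _) (hfg.const_mul _), integral_const_mul,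
      integral_const_mul] at h0
    linarith
  -- The nonnegative quadratic t ↦ ∫ (t g + f)² has nonpositive discriminant.
  have := discrim_le_zero h
  rw [discrim] at this
  linarith

/-- The entropy inequality (Donsker-Varadhan duality). -/
theorem integral_mul_le_entropy {Ω : Type*} [MeasurableSpace Ω] {μ : Measure Ω}
    [IsProbabilityMeasure μ] {F X : Ω → ℝ} (hF0 : ∀ x, 0 < F x) (hF : Integrable F μ)
    (hFlog : Integrable (fun x => mulLog (F x)) μ) (hFX : Integrable (fun x => F x * X x) μ)
    (hX : Integrable (fun x => Real.exp (X x)) μ) :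
    ∫ x, F x * X x ∂μ ≤ ∫ x, mulLog (F x) ∂μ - mulLog (∫ x, F x ∂μ)
      + (∫ x, F x ∂μ) * Real.log (∫ x, Real.exp (X x) ∂μ) := by
  set k := ∫ x, F x ∂μ with hk
  set E := ∫ x, Real.exp (X x) ∂μ with hE
  have hk0 : 0 < k := by
    refine (integral_pos_iff_support_of_nonneg (fun x => (hF0 x).le) hF).mpr ?_
    have : Function.support F = Set.univ := Set.eq_univ_of_forall fun x => (hF0 x).ne'
    simp [this]
  have hE0 : 0 < E := integral_exp_pos hX
  -- This is 1 + s ≤ exp s, multiplied by F, where s is the log-ratio of the normalised densities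
  -- exp(X)/E and F/k. After integration the extra terms ±k cancel.
  have key : ∀ x, F x * X x ≤ (mulLog (F x) - (Real.log k + 1 - Real.log E) * F x)
      + k / E * Real.exp (X x) := by
    intro x
    have h1 := Real.add_one_le_exp (X x - Real.log E - (Real.log (F x) - Real.log k))
    have h2 : Real.exp (X x - Real.log E - (Real.log (F x) - Real.log k))
        = Real.exp (X x) / E / (F x / k) := by
      rw [Real.exp_sub, Real.exp_sub, Real.exp_sub, Real.exp_log hE0, Real.exp_log (hF0 x),
        Real.exp_log hk0]
    rw [h2] at h1
    have h3 := mul_le_mul_of_nonneg_left h1 (hF0 x).le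
    have h4 : F x * (Real.exp (X x) / E / (F x / k)) = k / E * Real.exp (X x) := by
      have := (hF0 x).ne'
      field_simp
    rw [h4] at h3
    rw [mulLog]
    nlinarith
  have hint := (hFlog.sub (hF.const_mul (Real.log k + 1 - Real.log E)))
  have := integral_mono hFX (hint.add (hX.const_mul (k / E))) key
  rw [integral_add' hint (hX.const_mul (k / E)),
    integral_sub' hFlog (hF.const_mul _), integral_const_mul, integral_const_mul,
    ← hk, ← hE, div_mul_cancel₀ _ hE0.ne'] at this
  refine this.trans (le_of_eq ?_)
  rw [mulLog]
  ring

section Score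

variable {d : ℕ} {G : Euc d → Euc d → ℝ} {F : Euc d → Euc d → ℝ} {M N : ℝ}

/-- Since the score is centred, F may be replaced by F - k. Pairing the resulting vector v with
itself and applying Cauchy-Schwarz gives ‖v‖⁴ ≤ Var(F) · L²‖v‖², and ‖v‖² is divided out. -/
theorem norm_integral_smul_score_sq_le_of_var (hG : Measurable (Function.uncurry G))
    (hZ : ∀ y, Integrable (fun x => Real.exp (-G x y)))
    (hdiff : ∀ x, Differentiable ℝ (fun y => condDensity G x y)) {L : ℝ}
    (hV : VarCriterion G L) (hF : BddGradient F M N) {y : Euc d}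
    (hy : ∫ x, score G x y ∂condLaw G y = 0) :
    ‖∫ x, F x y • score G x y ∂condLaw G y‖ ^ 2
      ≤ L ^ 2 * phiEntropy (fun t => t ^ 2) (condLaw G y) (fun x => F x y) := by
  have := isProbabilityMeasure_condLaw hZ y
  have hs := hV.integrable_score hG hZ hdiff y
  have hFs := hF.integrable_smul_score hG hZ hdiff hV y
  set v := ∫ x, F x y • score G x y ∂condLaw G y with hv
  set k := ∫ x, F x y ∂condLaw G y with hk
  have hFi : Integrable (fun x => F x y) (condLaw G y) := hF.integrable hZ y
  have hF2 : Integrable (fun x => F x y ^ 2) (condLaw G y) :=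
    .of_bound ((hF.measurable_left y).pow_const 2).aestronglyMeasurable (M ^ 2)
      (ae_of_all _ fun x => by
        rw [norm_pow]
        exact pow_le_pow_left₀ (norm_nonneg _) (hF.bound x y) 2)
  have hX : Integrable (fun x => inner ℝ v (score G x y)) (condLaw G y) := hs.const_inner v
  have hFX : Integrable (fun x => F x y * inner ℝ v (score G x y)) (condLaw G y) := by
    have : Integrable (fun x => inner ℝ v (F x y • score G x y)) (condLaw G y) :=
      hFs.const_inner v
    simpa only [inner_smul_right] using this
  have hexp : (fun x => (F x y - k) ^ 2) = fun x => F x y ^ 2 - (2 * k * F x y - k ^ 2) := by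
    funext x; ring
  have hi : Integrable (fun x => 2 * k * F x y - k ^ 2) (condLaw G y) :=
    (hFi.const_mul (2 * k)).sub (integrable_const _)
  have hvar : ∫ x, (F x y - k) ^ 2 ∂condLaw G y
      = phiEntropy (fun t => t ^ 2) (condLaw G y) (fun x => F x y) := by
    rw [hexp, integral_sub hF2 hi, integral_sub (hFi.const_mul (2 * k)) (integrable_const _),
      integral_const_mul, ← hk, integral_const, probReal_univ, phiEntropy, ← hk, one_smul]
    ring
  have hprod : (fun x => (F x y - k) * inner ℝ v (score G x y))
      = fun x => F x y * inner ℝ v (score G x y) - k * inner ℝ v (score G x y) := by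
    funext x; ring
  have hcs := sq_integral_mul_le (μ := condLaw G y) (f := fun x => F x y - k)
    (g := fun x => inner ℝ v (score G x y)) (hexp ▸ hF2.sub hi) (hV v y).1
    (hprod ▸ hFX.sub (hX.const_mul k))
  have hnorm : ∫ x, (F x y - k) * inner ℝ v (score G x y) ∂condLaw G y = ‖v‖ ^ 2 := by
    rw [hprod, integral_sub hFX (hX.const_mul k), integral_const_mul, integral_inner hs, hy,
      inner_zero_right, mul_zero, sub_zero, ← real_inner_self_eq_norm_sq]
    nth_rewrite 3 [hv]
    rw [← integral_inner hFs]
    simp only [inner_smul_right]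
  rw [hnorm, hvar] at hcs
  set e := phiEntropy (fun t => t ^ 2) (condLaw G y) (fun x => F x y)
  have he : 0 ≤ e := hvar ▸ integral_nonneg fun x => sq_nonneg _
  have h1 : (‖v‖ ^ 2) ^ 2 ≤ e * (L ^ 2 * ‖v‖ ^ 2) :=
    hcs.trans (mul_le_mul_of_nonneg_left (hV v y).2 he)
  rcases (sq_nonneg ‖v‖).eq_or_lt with h0 | h0
  · rw [← h0]; positivity
  · refine le_of_mul_le_mul_right ?_ h0
    linarith

/-- Exponential moments in the directions ±w dominate the second moment. The constant is crude, but
it only feeds the regularity results, which are stated under the variance criterion. -/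
theorem MGFCriterion.varCriterion
    (hG : Measurable (Function.uncurry G))
    (hZ : ∀ y, Integrable (fun x => Real.exp (-G x y)))
    (hdiff : ∀ x, Differentiable ℝ (fun y => condDensity G x y)) {L : ℝ}
    (h : MGFCriterion G L) : VarCriterion G (2 * Real.exp (L ^ 2 / 4)) := by
  intro u y
  have := isProbabilityMeasure_condLaw hZ y
  rcases eq_or_ne u 0 with rfl | hu
  · simp
  have hu0 : 0 < ‖u‖ := norm_pos_iff.mpr hu
  -- The exponential bound is not homogeneous in u, so it is used for unit vectors and then scaled.
  set w := ‖u‖⁻¹ • u with hw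
  have hwn : ‖w‖ = 1 := by
    rw [hw, norm_smul, norm_inv, norm_norm, inv_mul_cancel₀ hu0.ne']
  have hexp : ∀ w : Euc d, ‖w‖ = 1 →
      ∫ x, Real.exp (inner ℝ w (score G x y)) ∂condLaw G y ≤ Real.exp (L ^ 2 / 2) := by
    intro w hw
    have h1 := (h w y).2
    rw [hw, Real.log_le_iff_le_exp (integral_exp_pos (h w y).1)] at h1
    simpa using h1
  -- Adds 1 + t + t²/2 ≤ exp t and 1 - t ≤ exp(-t) at t = |X|.
  have hpt : ∀ X : ℝ, X ^ 2 ≤ 2 * (Real.exp X + Real.exp (-X)) := by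
    intro X
    rw [← sq_abs, show Real.exp X + Real.exp (-X) = Real.exp |X| + Real.exp (-|X|) by
      rcases abs_cases X with ⟨h, _⟩ | ⟨h, _⟩ <;> simp [h, add_comm]]
    have h1 := Real.quadratic_le_exp_of_nonneg (abs_nonneg X)
    have h2 := Real.add_one_le_exp (-|X|)
    linarith
  have hi1 := (h w y).1
  have hi2 : Integrable (fun x => Real.exp (-inner ℝ w (score G x y))) (condLaw G y) := by
    simpa only [inner_neg_left] using (h (-w) y).1
  have hdom : Integrable (fun x => 2 * (Real.exp (inner ℝ w (score G x y))
      + Real.exp (-inner ℝ w (score G x y)))) (condLaw G y) := (hi1.add hi2).const_mul 2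
  have hwint : Integrable (fun x => inner ℝ w (score G x y) ^ 2) (condLaw G y) := by
    refine hdom.mono' ?_ (ae_of_all _ fun x => ?_)
    · have hm : Measurable fun x => inner ℝ w (score G x y) :=
        (measurable_score_left hG hZ hdiff y).const_inner
      exact (hm.pow_const 2).aestronglyMeasurable
    · rw [Real.norm_of_nonneg (sq_nonneg _)]
      exact hpt _
  have hwle : ∫ x, inner ℝ w (score G x y) ^ 2 ∂condLaw G y ≤ 4 * Real.exp (L ^ 2 / 2) := by
    refine (integral_mono hwint hdom fun x => hpt _).trans ?_
    rw [integral_const_mul, integral_add hi1 hi2]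
    have h1 := hexp w hwn
    have h2 := hexp (-w) (by rw [norm_neg, hwn])
    simp only [inner_neg_left] at h2
    linarith
  have heq : (fun x => inner ℝ u (score G x y) ^ 2)
      = fun x => ‖u‖ ^ 2 * inner ℝ w (score G x y) ^ 2 := by
    funext x
    rw [hw, real_inner_smul_left]
    field_simp
  rw [heq]
  refine ⟨hwint.const_mul _, ?_⟩
  rw [integral_const_mul, mul_pow, ← Real.exp_nat_mul, mul_comm]
  have h3 : ((2 : ℕ) : ℝ) * (L ^ 2 / 4) = L ^ 2 / 2 := by push_cast; ring
  rw [h3]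
  exact mul_le_mul_of_nonneg_right (hwle.trans_eq (by norm_num)) (sq_nonneg _)

/-- The entropy inequality is tested on X = ⟨τ v, score⟩, where v is the vector to be bounded. No
separate centring of the score is needed, so the bound holds for every y. -/
theorem norm_integral_smul_score_sq_le_of_mgf (hG : Measurable (Function.uncurry G))
    (hZ : ∀ y, Integrable (fun x => Real.exp (-G x y)))
    (hdiff : ∀ x, Differentiable ℝ (fun y => condDensity G x y)) {L : ℝ} (hL : 0 < L)
    (hMGF : MGFCriterion G L) (hF : BddGradient F M N) (hF0 : ∀ x y, 0 < F x y) (y : Euc d) :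
    ‖∫ x, F x y • score G x y ∂condLaw G y‖ ^ 2
      ≤ 2 * L ^ 2 * condAvg G F y * phiEntropy mulLog (condLaw G y) (fun x => F x y) := by
  have := isProbabilityMeasure_condLaw hZ y
  have hV := hMGF.varCriterion hG hZ hdiff
  have hFs := hF.integrable_smul_score hG hZ hdiff hV y
  have hFi : Integrable (fun x => F x y) (condLaw G y) := hF.integrable hZ y
  set v := ∫ x, F x y • score G x y ∂condLaw G y with hv
  set k := condAvg G F y with hk
  have hk0 : 0 < k := by
    refine (integral_pos_iff_support_of_nonneg (fun x => (hF0 x y).le) hFi).mpr ?_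
    have : (Function.support fun x => F x y) = Set.univ :=
      Set.eq_univ_of_forall fun x => (hF0 x y).ne'
    simp [this]
  have hcont : Continuous mulLog := Real.continuous_mul_log
  obtain ⟨P, hP⟩ := (isCompact_closedBall (0 : ℝ) M).exists_bound_of_continuousOn
    hcont.continuousOn
  have hlog : Integrable (fun x => mulLog (F x y)) (condLaw G y) :=
    .of_bound (hcont.measurable.comp (hF.measurable_left y)).aestronglyMeasurable P
      (ae_of_all _ fun x => hP _ (by simpa using hF.bound x y))
  -- This τ maximises τ‖v‖² - k L² τ² ‖v‖²/2; half of the linear term is then absorbed.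
  set τ := 1 / (k * L ^ 2) with hτ
  have hFX : ∀ u : Euc d,
      Integrable (fun x => F x y * inner ℝ u (score G x y)) (condLaw G y) := fun u => by
    have : Integrable (fun x => inner ℝ u (F x y • score G x y)) (condLaw G y) :=
      hFs.const_inner u
    simpa only [inner_smul_right] using this
  have h1 := integral_mul_le_entropy (fun x => hF0 x y) hFi hlog (hFX (τ • v)) (hMGF (τ • v) y).1
  have h2 : ∫ x, F x y * inner ℝ (τ • v) (score G x y) ∂condLaw G y = τ * ‖v‖ ^ 2 := by
    have h3 : ∫ x, inner ℝ (τ • v) (F x y • score G x y) ∂condLaw G y = inner ℝ (τ • v) v :=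
      integral_inner hFs (τ • v)
    rw [real_inner_smul_left, real_inner_self_eq_norm_sq] at h3
    rw [← h3]
    simp only [inner_smul_right]
  have h4 := mul_le_mul_of_nonneg_left (hMGF (τ • v) y).2 hk0.le
  have hnorm : ‖τ • v‖ ^ 2 = τ ^ 2 * ‖v‖ ^ 2 := by
    rw [norm_smul, mul_pow, Real.norm_eq_abs, sq_abs]
  rw [hnorm] at h4
  rw [h2] at h1
  have h5 : τ * ‖v‖ ^ 2 ≤ phiEntropy mulLog (condLaw G y) (fun x => F x y)
      + k * (L ^ 2 * (τ ^ 2 * ‖v‖ ^ 2) / 2) := h1.trans (by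
    rw [phiEntropy]
    exact add_le_add_right h4 _)
  have h6 : k * (L ^ 2 * (τ ^ 2 * ‖v‖ ^ 2) / 2) = τ * ‖v‖ ^ 2 / 2 := by
    rw [hτ]; field_simp
  have h7 : ‖v‖ ^ 2 = 2 * L ^ 2 * k * (τ * ‖v‖ ^ 2 / 2) := by
    rw [hτ]; field_simp
  rw [h7]
  refine mul_le_mul_of_nonneg_left ?_ (by positivity)
  linarith

end Score

theorem deriv_deriv_sq : deriv (deriv fun t : ℝ => t ^ 2) = fun _ => 2 := by
  have : (deriv fun t : ℝ => t ^ 2) = fun t => 2 * t := by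
    funext t; simp
  rw [this]
  funext t
  simp

theorem deriv_deriv_mulLog (t : ℝ) : deriv (deriv mulLog) t = t⁻¹ := Real.deriv2_mul_log t

/-! ### The Poincaré and log-Sobolev inequalities for the joint law -/

section Conclusions

variable {d : ℕ} {G : Euc d → Euc d → ℝ} {ρ : Measure (Euc d)} [IsProbabilityMeasure ρ]

theorem poincare_jointLaw (hρ : ρ ≪ volume) (hG : Measurable (Function.uncurry G))
    (hZ : ∀ y, Integrable (fun x => Real.exp (-G x y)))
    (hdiff : ∀ x, Differentiable ℝ (fun y => condDensity G x y))
    {α β L : ℝ} (hζ : 0 < zeta α β L)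
    (hα : PhiSobolev Set.univ (fun t => t ^ 2) ρ α)
    (hβ : ∀ y, PhiSobolev Set.univ (fun t => t ^ 2) (condLaw G y) β)
    (hV : VarCriterion G L) : Poincare (jointLaw G ρ) (zeta α β L) := by
  refine ⟨hζ, fun f hf hfc => ?_⟩
  have := isProbabilityMeasure_jointLaw (ρ := ρ) hG hZ
  have hfd : Differentiable ℝ f := hf.differentiable (by simp)
  obtain ⟨M, hM⟩ := hfc.exists_bound_of_continuous hf.continuous
  have hc : HasCompactSupport fun z => f z - 0 := by simpa using hfc
  obtain ⟨N, hN⟩ := exists_bound_gradient hf hc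
  have hF := bddGradient_slice hf hM hN
  have hvar : ProbabilityTheory.variance f (jointLaw G ρ)
      = phiEntropy (fun t => t ^ 2) (jointLaw G ρ) f :=
    ProbabilityTheory.variance_eq_sub
      (MemLp.of_bound hf.continuous.aestronglyMeasurable M (ae_of_all _ hM))
  rw [hvar]
  refine le_zeta_mul (integral_nonneg fun z => sq_nonneg _) fun C hC => ?_
  have hmain := phiEntropy_jointLaw_le (L := L) (C := C) hρ hG hZ hdiff hV hα hβ
    (by fun_prop) (by rw [deriv_deriv_sq]; fun_prop) (by simp [deriv_deriv_sq])
    (Set.subset_univ (Set.Icc (-M) M)) hf hc (fun z => abs_le.mp (hM z)) (by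
      filter_upwards [hρ.ae_le (hV.ae_integral_score_eq_zero hG hZ hdiff)] with y hy
      have := isProbabilityMeasure_condLaw hZ y
      simp only [deriv_deriv_sq, condAvg, integral_const_mul]
      have h1 := norm_integral_smul_score_sq_le_of_var hG hZ hdiff hV hF hy
      have h2 := (hβ y).2 _ (hf.comp (contDiff_toLp_left y))
        ⟨0, hasCompactSupport_slice_left hc y⟩ fun x => Set.mem_univ _
      simp only [deriv_deriv_sq, integral_const_mul, Function.comp_def] at h2
      -- Jensen's inequality for the squared norm, as Cauchy-Schwarz with weight 1.
      have h3 : ‖∫ x, gradient (fun y => f (WithLp.toLp 2 (x, y))) y ∂condLaw G y‖ ^ 2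
          ≤ ∫ x, ‖gradient (fun y => f (WithLp.toLp 2 (x, y))) y‖ ^ 2 ∂condLaw G y := by
        have hi := hF.integrable_gradient hZ y
        have hi2 : Integrable (fun x => ‖gradient (fun y => f (WithLp.toLp 2 (x, y))) y‖ ^ 2)
            (condLaw G y) := .of_bound (hi.aestronglyMeasurable.norm.pow 2) (N ^ 2)
          (ae_of_all _ fun x => by
            rw [norm_pow, norm_norm]
            exact pow_le_pow_left₀ (norm_nonneg _) (hF.gradient_bound x y) 2)
        have h4 := sq_integral_le_weighted (w := fun _ => 1) hi.norm (integrable_const _)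
          (by simpa using hi2) (by simp)
        simp only [integral_const, probReal_univ, smul_eq_mul, mul_one, one_mul, div_one] at h4
        exact (pow_le_pow_left₀ (norm_nonneg _) (norm_integral_le_integral_norm _) 2).trans h4
      have h5 := norm_add_sq_le_of_pos hC
        (∫ x, gradient (fun y => f (WithLp.toLp 2 (x, y))) y ∂condLaw G y)
        (∫ x, f (WithLp.toLp 2 (x, y)) • score G x y ∂condLaw G y)
      have h6 := mul_le_mul_of_nonneg_left h3 (by positivity : 0 ≤ 1 + C)
      have h7 := mul_le_mul_of_nonneg_left
        (h1.trans (mul_le_mul_of_nonneg_left h2 (sq_nonneg L))) (by positivity : 0 ≤ 1 + C⁻¹)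
      rw [condAvgGrad]
      linarith)
  simp only [deriv_deriv_sq, integral_const_mul] at hmain
  linarith

/-- Both summands of ∇k have squared norm bounded by k times an energy, and Φ''(k) = 1/k removes the
factor. The 2 from the entropy bound cancels against β/2. -/
theorem phiEntropy_mulLog_jointLaw_le (hρ : ρ ≪ volume) (hG : Measurable (Function.uncurry G))
    (hZ : ∀ y, Integrable (fun x => Real.exp (-G x y)))
    (hdiff : ∀ x, Differentiable ℝ (fun y => condDensity G x y))
    {α β L C : ℝ} (hL : 0 < L) (hC : 0 < C)
    (hα : PhiSobolev (Set.Ioi 0) mulLog ρ α)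
    (hβ : ∀ y, PhiSobolev (Set.Ioi 0) mulLog (condLaw G y) β)
    (hMGF : MGFCriterion G L) {f : EucProd d → ℝ} (hf : ContDiff ℝ ∞ f) {c : ℝ}
    (hc : HasCompactSupport fun z => f z - c) {a b : ℝ} (ha : 0 < a)
    (hab : ∀ z, f z ∈ Set.Icc a b) :
    phiEntropy mulLog (jointLaw G ρ) f ≤ max (β + α * (1 + C⁻¹) * L ^ 2 * β) (α * (1 + C)) / 2 *
      ∫ z, (f z)⁻¹ * ‖gradient f z‖ ^ 2 ∂jointLaw G ρ := by
  have hV := hMGF.varCriterion hG hZ hdiff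
  have hf0 : ∀ z, 0 < f z := fun z => ha.trans_le (hab z).1
  have hM : ∀ z, ‖f z‖ ≤ b := fun z => by
    rw [Real.norm_of_nonneg (hf0 z).le]; exact (hab z).2
  obtain ⟨N, hN⟩ := exists_bound_gradient hf hc
  have hF := bddGradient_slice hf hM hN
  have hS : Set.Icc a b ⊆ Set.Ioi 0 := fun t ht => ha.trans_le ht.1
  have hmain := phiEntropy_jointLaw_le (L := L) (C := C) hρ hG hZ hdiff hV hα hβ
    Real.continuous_mul_log ?_ ?_ hS hf hc hab (ae_of_all _ fun y => ?_)
  · simpa only [deriv_deriv_mulLog] using hmain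
  · simp only [funext deriv_deriv_mulLog]
    exact continuousOn_inv₀.mono fun t ht => (Set.mem_Ioi.mp ht).ne'
  · intro t ht
    rw [deriv_deriv_mulLog]
    exact inv_nonneg.mpr (Set.mem_Ioi.mp ht).le
  · have := isProbabilityMeasure_condLaw hZ y
    simp only [deriv_deriv_mulLog]
    have h1 := norm_integral_smul_score_sq_le_of_mgf hG hZ hdiff hL hMGF hF (fun _ _ => hf0 _) y
    have h2 := (hβ y).2 _ (hf.comp (contDiff_toLp_left y))
      ⟨c, hasCompactSupport_slice_left hc y⟩ fun x => hf0 _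
    simp only [deriv_deriv_mulLog, Function.comp_def] at h2
    have hFi := hF.integrable hZ y
    set k := condAvg G (fun x y => f (WithLp.toLp 2 (x, y))) y with hk
    have hk0 : 0 < k := by
      have := integral_mono (integrable_const a) hFi fun x => (hab _).1
      rw [integral_const, probReal_univ, one_smul] at this
      exact ha.trans_le this
    -- Cauchy-Schwarz weighted by f itself, whose mean is k.
    have h3 : ‖∫ x, gradient (fun y => f (WithLp.toLp 2 (x, y))) y ∂condLaw G y‖ ^ 2
        ≤ k * condAvg G (fun x y => (f (WithLp.toLp 2 (x, y)))⁻¹ *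
          ‖gradient (fun y => f (WithLp.toLp 2 (x, y))) y‖ ^ 2) y := by
      have hi := hF.integrable_gradient hZ y
      have hi2 : Integrable (fun x => ‖gradient (fun y => f (WithLp.toLp 2 (x, y))) y‖ ^ 2
          / f (WithLp.toLp 2 (x, y))) (condLaw G y) :=
        .of_bound ((hi.aestronglyMeasurable.norm.pow 2).div₀ hFi.aestronglyMeasurable) (N ^ 2 / a)
        (ae_of_all _ fun x => by
          rw [norm_div, norm_pow, norm_norm, Real.norm_of_nonneg (hf0 _).le]
          exact div_le_div₀ (sq_nonneg _) (pow_le_pow_left₀ (norm_nonneg _)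
            (hF.gradient_bound x y) 2) ha (hab _).1)
      have h4 := sq_integral_le_weighted hi.norm hFi hi2 fun x => hf0 _
      simp only [div_eq_inv_mul] at h4
      exact (pow_le_pow_left₀ (norm_nonneg _) (norm_integral_le_integral_norm _) 2).trans h4
    have h5 := norm_add_sq_le_of_pos hC
      (∫ x, gradient (fun y => f (WithLp.toLp 2 (x, y))) y ∂condLaw G y)
      (∫ x, f (WithLp.toLp 2 (x, y)) • score G x y ∂condLaw G y)
    have h6 := mul_le_mul_of_nonneg_left h3 (by positivity : 0 ≤ 1 + C)
    have h7 := mul_le_mul_of_nonneg_left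
      (h1.trans (mul_le_mul_of_nonneg_left h2 (by positivity))) (by positivity : 0 ≤ 1 + C⁻¹)
    rw [condAvgGrad, inv_mul_le_iff₀ hk0]
    refine h5.trans ((add_le_add h6 h7).trans_eq ?_)
    simp only [condAvg]
    ring

theorem norm_gradient_sq_add_const {E : Type*} [NormedAddCommGroup E] [InnerProductSpace ℝ E]
    [CompleteSpace E] {f : E → ℝ} (hf : Differentiable ℝ f) (δ : ℝ) (z : E) :
    ‖gradient (fun z => f z ^ 2 + δ) z‖ = 2 * |f z| * ‖gradient f z‖ := by
  rw [norm_gradient_eq, norm_gradient_eq, (((hf z).hasFDerivAt.pow 2).add_const δ).fderiv,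
    norm_smul]
  simp

theorem logSobolev_jointLaw (hρ : ρ ≪ volume) (hG : Measurable (Function.uncurry G))
    (hZ : ∀ y, Integrable (fun x => Real.exp (-G x y)))
    (hdiff : ∀ x, Differentiable ℝ (fun y => condDensity G x y))
    {α β L : ℝ} (hL : 0 < L) (hζ : 0 < zeta α β L)
    (hα : PhiSobolev (Set.Ioi 0) mulLog ρ α)
    (hβ : ∀ y, PhiSobolev (Set.Ioi 0) mulLog (condLaw G y) β)
    (hMGF : MGFCriterion G L) : LogSobolev (jointLaw G ρ) (zeta α β L) := by
  refine ⟨hζ, fun f hf hfc => ?_⟩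
  have := isProbabilityMeasure_jointLaw (ρ := ρ) hG hZ
  have hfd : Differentiable ℝ f := hf.differentiable (by simp)
  obtain ⟨M, hM⟩ := hfc.exists_bound_of_continuous hf.continuous
  have hM2 : ∀ z, f z ^ 2 ≤ M ^ 2 := fun z => by
    rw [← sq_abs]; exact pow_le_pow_left₀ (abs_nonneg _) (hM z) 2
  obtain ⟨N, hN⟩ := exists_bound_gradient hf (c := 0) (by simpa using hfc)
  have hgi : Integrable (fun z => ‖gradient f z‖ ^ 2) (jointLaw G ρ) :=
    .of_bound ((continuous_gradient hf).norm.pow 2).aestronglyMeasurable (N ^ 2)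
      (ae_of_all _ fun z => by
        rw [norm_pow, norm_norm]
        exact pow_le_pow_left₀ (norm_nonneg _) (hN z) 2)
  have hI : 0 ≤ ∫ z, ‖gradient f z‖ ^ 2 ∂jointLaw G ρ := integral_nonneg fun z => sq_nonneg _
  -- The function f² may vanish, whereas f² + δ is positive and constant outside a compact set. Its
  -- energy density 4f²‖∇f‖²/(f² + δ) is at most 4‖∇f‖², uniformly in δ.
  have hδ : ∀ δ : ℝ, 0 < δ → phiEntropy mulLog (jointLaw G ρ) (fun z => f z ^ 2 + δ)
      ≤ zeta α β L * (2 * ∫ z, ‖gradient f z‖ ^ 2 ∂jointLaw G ρ) := by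
    intro δ hδ
    refine le_zeta_mul (by positivity) fun C hC => ?_
    have hα0 := hα.1
    refine (phiEntropy_mulLog_jointLaw_le hρ hG hZ hdiff hL hC hα hβ hMGF
      (f := fun z => f z ^ 2 + δ) (c := δ) (a := δ) (b := M ^ 2 + δ)
      ((hf.pow 2).add contDiff_const) ?_ hδ fun z => ?_).trans ?_
    · simp only [add_sub_cancel_right]
      exact hfc.comp_left (g := fun t : ℝ => t ^ 2) (by simp)
    · exact ⟨le_add_of_nonneg_left (sq_nonneg _), add_le_add_left (hM2 z) δ⟩
    · have hle : ∫ z, (f z ^ 2 + δ)⁻¹ * ‖gradient (fun z => f z ^ 2 + δ) z‖ ^ 2 ∂jointLaw G ρ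
          ≤ 4 * ∫ z, ‖gradient f z‖ ^ 2 ∂jointLaw G ρ := by
        rw [← integral_const_mul]
        refine integral_mono_of_nonneg (ae_of_all _ fun z => by positivity) (hgi.const_mul 4)
          (ae_of_all _ fun z => ?_)
        simp only
        rw [norm_gradient_sq_add_const hfd, inv_mul_le_iff₀ (by positivity), mul_pow, mul_pow,
          sq_abs]
        nlinarith [mul_nonneg hδ.le (sq_nonneg ‖gradient f z‖)]
      have hmax : 0 ≤ max (β + α * (1 + C⁻¹) * L ^ 2 * β) (α * (1 + C)) :=
        le_max_of_le_right (by positivity)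
      have := mul_le_mul_of_nonneg_left hle (by positivity :
        0 ≤ max (β + α * (1 + C⁻¹) * L ^ 2 * β) (α * (1 + C)) / 2)
      linarith
  -- Letting δ → 0 uses the continuity of t log t at 0, which also bounds it on [0, M² + 1] for
  -- dominated convergence.
  have hcont : Continuous mulLog := Real.continuous_mul_log
  obtain ⟨P, hP⟩ := (isCompact_Icc (a := (0 : ℝ)) (b := M ^ 2 + 1)).exists_bound_of_continuousOn
    hcont.continuousOn
  have hseq := tendsto_one_div_add_atTop_nhds_zero_nat (𝕜 := ℝ)
  have hpt : ∀ z, Tendsto (fun n : ℕ => f z ^ 2 + 1 / ((n : ℝ) + 1)) atTop (𝓝 (f z ^ 2)) :=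
    fun z => by simpa using hseq.const_add (f z ^ 2)
  have hle1 : ∀ n : ℕ, 1 / ((n : ℝ) + 1) ≤ 1 := fun n => by
    rw [div_le_one (by positivity)]
    exact le_add_of_nonneg_left n.cast_nonneg
  have hmem : ∀ (n : ℕ) z, f z ^ 2 + 1 / ((n : ℝ) + 1) ∈ Set.Icc 0 (M ^ 2 + 1) := fun n z =>
    ⟨by positivity, add_le_add (hM2 z) (hle1 n)⟩
  have hc2 : ∀ n : ℕ, Continuous fun z => f z ^ 2 + 1 / ((n : ℝ) + 1) := fun n =>
    (hf.continuous.pow 2).add continuous_const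
  have hmean : Tendsto (fun n : ℕ => ∫ z, (f z ^ 2 + 1 / ((n : ℝ) + 1)) ∂jointLaw G ρ) atTop
      (𝓝 (∫ z, f z ^ 2 ∂jointLaw G ρ)) :=
    tendsto_integral_of_dominated_convergence (fun _ => M ^ 2 + 1)
      (fun n => (hc2 n).aestronglyMeasurable) (integrable_const _)
      (fun n => ae_of_all _ fun z => by
        rw [Real.norm_of_nonneg (hmem n z).1]; exact (hmem n z).2) (ae_of_all _ hpt)
  have hlog : Tendsto (fun n : ℕ => ∫ z, mulLog (f z ^ 2 + 1 / ((n : ℝ) + 1)) ∂jointLaw G ρ) atTop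
      (𝓝 (∫ z, mulLog (f z ^ 2) ∂jointLaw G ρ)) :=
    tendsto_integral_of_dominated_convergence (fun _ => P)
      (fun n => (hcont.comp (hc2 n)).aestronglyMeasurable) (integrable_const _)
      (fun n => ae_of_all _ fun z => hP _ (hmem n z))
      (ae_of_all _ fun z => (hcont.tendsto _).comp (hpt z))
  have hlim := le_of_tendsto' (hlog.sub ((hcont.tendsto _).comp hmean))
    fun n : ℕ => hδ (1 / ((n : ℝ) + 1)) (by positivity)
  calc phiEntropy mulLog (jointLaw G ρ) (fun z => f z ^ 2)
      ≤ zeta α β L * (2 * ∫ z, ‖gradient f z‖ ^ 2 ∂jointLaw G ρ) := hlim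
    _ = _ := by ring

end Conclusions

theorem zeta_pos {α β L : ℝ} (hα : 0 < α) (hβ : 0 < β) (hL : 0 < L) : 0 < zeta α β L := by
  rw [zeta_eq hα hβ hL]
  positivity

end TwoScale

theorem theorem1 (d : ℕ) (ρ : Measure (TwoScale.Euc d)) [IsProbabilityMeasure ρ]
    (hρ : ρ ≪ volume)
    (G : TwoScale.Euc d → TwoScale.Euc d → ℝ) (hG : Measurable (Function.uncurry G))
    (hZ : ∀ y, Integrable (fun x => Real.exp (-G x y)))
    (hdiff : ∀ x, Differentiable ℝ (fun y => TwoScale.condDensity G x y))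
    (α β L : ℝ) (hα : 0 < α) (hβ : 0 < β) (hL : 0 < L) :
    TwoScale.zeta α β L =
        (α + β + α * β * L ^ 2
          + Real.sqrt (4 * α ^ 2 * β * L ^ 2 + (β - α + α * β * L ^ 2) ^ 2)) / 2 ∧
    (TwoScale.PhiSobolev Set.univ (fun t => t ^ 2) ρ α →
      (∀ y, TwoScale.PhiSobolev Set.univ (fun t => t ^ 2) (TwoScale.condLaw G y) β) →
      TwoScale.VarCriterion G L →
      TwoScale.Poincare (TwoScale.jointLaw G ρ) (TwoScale.zeta α β L)) ∧
    (TwoScale.PhiSobolev (Set.Ioi 0) TwoScale.mulLog ρ α →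
      (∀ y, TwoScale.PhiSobolev (Set.Ioi 0) TwoScale.mulLog (TwoScale.condLaw G y) β) →
      TwoScale.MGFCriterion G L →
      TwoScale.LogSobolev (TwoScale.jointLaw G ρ) (TwoScale.zeta α β L)) := by
  have hζ := TwoScale.zeta_pos hα hβ hL
  exact ⟨TwoScale.zeta_eq hα hβ hL,
    fun hα' hβ' hV => TwoScale.poincare_jointLaw hρ hG hZ hdiff hζ hα' hβ' hV,
    fun hα' hβ' hM => TwoScale.logSobolev_jointLaw hρ hG hZ hdiff hL hζ hα' hβ' hM⟩
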